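/- Let $A$ be a simple unital C*-algebra, let $P\subseteq A$ be a C*-subalgebra containing the unit of $A$, and let $E\colon A\to P$ be a conditional expectation of index-finite type, that is, there are $u_1,v_1,\dots,u_n,v_n\in A$ with $\sum_i u_iE(v_ix)=x=\sum_i E(xu_i)v_i$ for all $x\in A$; put $\mathrm{Index}\,E=\sum_i u_iv_i$, which does not depend on the choice of the $u_i,v_i$. Let $A^\infty=\ell^\infty(\mathbb N,A)/c_0(\mathbb N,A)$, with $A\subseteq A^\infty$ as constant sequences, and let $E^\infty$ be the map on $A^\infty$ that $E$ induces entrywise. Suppose that $E$ has the tracial Rokhlin property: for every nonzero positive $z\in A^\infty$ there is a projection $e\in A'\cap A^\infty$ such that $g=(\mathrm{Index}\,E)E^\infty(e)$ is a projection, $1-g$ is Murray–von Neumann equivalent to a projection in the hereditary subalgebra $\overline{zA^\infty z}$, and the map $A\ni x\mapsto xe$ is injective. Say that the order on projections over a unital C*-algebra $B$ is determined by traces if, for all $n$ and all projections $p,q\in M_n(B)$ with $\tau(p)<\tau(q)$ for every tracial state $\tau$ of $B$ (extended to $M_n(B)$ by $\tau(b)=\sum_i\tau(b_{ii})$), $p$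 is Murray–von Neumann equivalent in $M_n(B)$ to a subprojection of $q$. If the order on projections over $A$ is determined by traces, then the order on projections over $P$ is determined by traces. -/

import Mathlib

open Filter Topology
open scoped BoundedContinuousFunction ComplexOrder

noncomputable section

/-! ### Murray–von Neumann comparison, traces -/

/-- Murray–von Neumann equivalence of `p` and `q`. -/
def MvNEquiv {B : Type*} [Mul B] [Star B] (p q : B) : Prop :=
  ∃ v : B, star v * v = p ∧ v * star v = q

/-- `p` is Murray–von Neumann equivalent to a subprojection of `q`
(for projections, `r ≤ q` means `q * r = r`). -/
def MvNSubequiv {B : Type*} [NonUnitalSemiring B] [StarRing B] (p q : B) : Prop :=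
  ∃ r : B, IsStarProjection r ∧ q * r = r ∧ MvNEquiv p r

/-- Tracial states. -/
structure IsTracialState {B : Type*} [Ring B] [StarRing B] [Algebra ℂ B]
    (τ : B →ₗ[ℂ] ℂ) : Prop where
  map_one : τ 1 = 1
  nonneg : ∀ b, 0 ≤ τ (star b * b)
  trace : ∀ b c, τ (b * c) = τ (c * b)

/-- The order on projections over `B` is determined by traces: for projections `p`, `q` in a matrix
algebra `Mₙ(B)`, if `τ(p) < τ(q)` for every tracial state `τ` of `B`, then `p ≾ q`. Here `τ` is
extended to `Mₙ(B)` by `τ(p) = ∑ᵢ τ(pᵢᵢ)`, which is real on projections. -/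
def OrderOnProjectionsDeterminedByTraces (B : Type*) [Ring B] [StarRing B] [Algebra ℂ B] : Prop :=
  ∀ (n : ℕ) (p q : Matrix (Fin n) (Fin n) B), IsStarProjection p → IsStarProjection q →
    (∀ τ : B →ₗ[ℂ] ℂ, IsTracialState τ → (∑ i, τ (p i i)).re < (∑ i, τ (q i i)).re) →
    MvNSubequiv p q

/-- Simplicity of a C*-algebra: it is nonzero and has no nontrivial closed two-sided ideals. -/
def IsSimpleCStarAlgebra (A : Type*) [CStarAlgebra A] : Prop :=
  Nontrivial A ∧ ∀ I : TwoSidedIdeal A, IsClosed (I : Set A) → I = ⊥ ∨ I = ⊤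

/-! ### The sequence algebra `A^∞ = ℓ^∞(ℕ, A) / c₀(ℕ, A)` -/

section SequenceAlgebra

variable (A : Type*) [CStarAlgebra A]

/-- The ideal `c₀(ℕ, A)` of the algebra `ℓ^∞(ℕ, A)` of bounded sequences. -/
def nullSeq : Ideal (ℕ →ᵇ A) where
  carrier := {x | Tendsto x atTop (𝓝 0)}
  add_mem' {x y} hx hy := by
    have h := Tendsto.add (show Tendsto x atTop (𝓝 0) from hx) (show Tendsto y atTop (𝓝 0) from hy)
    rw [add_zero] at h
    exact h
  zero_mem' := tendsto_const_nhds
  smul_mem' c x hx := by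
    refine squeeze_zero_norm (a := fun n => ‖c‖ * ‖x n‖) (fun n => ?_) ?_
    · exact (norm_mul_le _ _).trans
        (mul_le_mul_of_nonneg_right (c.norm_coe_le_norm n) (norm_nonneg _))
    · have h := (tendsto_norm_zero.comp (show Tendsto x atTop (𝓝 0) from hx)).const_mul ‖c‖
      rw [mul_zero] at h
      exact h

theorem mem_nullSeq {x : ℕ →ᵇ A} : x ∈ nullSeq A ↔ Tendsto x atTop (𝓝 0) := Iff.rfl

instance : (nullSeq A).IsTwoSided where
  mul_mem_of_left {x} c hx := by
    rw [mem_nullSeq] at hx ⊢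
    refine squeeze_zero_norm (a := fun n => ‖x n‖ * ‖c‖) (fun n => ?_) ?_
    · exact (norm_mul_le _ _).trans
        (mul_le_mul_of_nonneg_left (c.norm_coe_le_norm n) (norm_nonneg _))
    · have h := (tendsto_norm_zero.comp hx).mul_const ‖c‖
      rw [zero_mul] at h
      exact h

/-- The sequence algebra `A^∞`, with its quotient algebra structure and quotient norm. -/
abbrev SeqAlg := (ℕ →ᵇ A) ⧸ nullSeq A

theorem star_mem_nullSeq {x : ℕ →ᵇ A} (hx : x ∈ nullSeq A) : star x ∈ nullSeq A := by
  rw [mem_nullSeq] at hx ⊢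
  have h := hx.star
  rw [star_zero] at h
  exact h

/-- The involution of `A^∞`: `[(xₙ)]* = [(xₙ*)]`. -/
instance : StarRing (SeqAlg A) where
  star := Quotient.map' star fun x y h => by
    rw [Submodule.quotientRel_def] at h ⊢
    rw [← star_sub]
    exact star_mem_nullSeq A h
  star_involutive := by
    rintro ⟨x⟩
    exact congrArg (Ideal.Quotient.mk (nullSeq A)) (star_star x)
  star_mul := by
    rintro ⟨x⟩ ⟨y⟩
    exact congrArg (Ideal.Quotient.mk (nullSeq A)) (star_mul x y)
  star_add := by
    rintro ⟨x⟩ ⟨y⟩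
    exact congrArg (Ideal.Quotient.mk (nullSeq A)) (star_add x y)

variable {A}

/-- The class in `A^∞` of a bounded sequence. -/
def SeqAlg.mk (x : ℕ →ᵇ A) : SeqAlg A := Ideal.Quotient.mk (nullSeq A) x

theorem SeqAlg.star_mk (x : ℕ →ᵇ A) : star (SeqAlg.mk x) = SeqAlg.mk (star x) := rfl

/-- The embedding of `A` in `A^∞` by constant sequences. -/
def SeqAlg.const (a : A) : SeqAlg A := SeqAlg.mk (BoundedContinuousFunction.const ℕ a)

/-- The map `T^∞([(xₙ)]) = [(T xₙ)]` of `A^∞` induced by a bounded linear map `T` of `A`. -/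
def SeqAlg.map (T : A →L[ℂ] A) : SeqAlg A → SeqAlg A :=
  Quotient.map' (fun x => T.compLeftContinuousBounded ℕ x) fun x y h => by
    rw [Submodule.quotientRel_def] at h ⊢
    rw [← map_sub]
    have h' := (T.continuous.tendsto 0).comp ((mem_nullSeq A).1 h)
    rw [map_zero] at h'
    exact h'

theorem SeqAlg.map_mk (T : A →L[ℂ] A) (x : ℕ →ᵇ A) :
    SeqAlg.map T (SeqAlg.mk x) = SeqAlg.mk (T.compLeftContinuousBounded ℕ x) := rfl

end SequenceAlgebra

/-! ### Conditional expectations of finite index -/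

section ConditionalExpectation

variable {A : Type*} [CStarAlgebra A] {P : StarSubalgebra ℂ A}

/-- `E` is a conditional expectation of `A` onto `P`: a positive (bounded) linear
`P`-bimodule map which is the identity on `P`. -/
structure IsConditionalExpectation (E : A →L[ℂ] P) : Prop where
  map_coe : ∀ b : P, E b = b
  map_mul_left : ∀ (b : P) (a : A), E (b * a) = b * E a
  map_mul_right : ∀ (a : A) (b : P), E (a * b) = E a * b
  positive : ∀ a : A, ∃ b : P, E (star a * a) = star b * b

/-- The family `(uᵢ, vᵢ)` is a quasi-basis for `E`. -/
def IsQuasiBasis (E : A →L[ℂ] P) {n : ℕ} (u v : Fin n → A) : Prop :=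
  ∀ x : A, ∑ i, u i * (E (v i * x) : A) = x ∧ ∑ i, (E (x * u i) : A) * v i = x

/-- `E` is of index-finite type: it has a quasi-basis. -/
def IsIndexFinite (E : A →L[ℂ] P) : Prop :=
  ∃ (n : ℕ) (u v : Fin n → A), IsQuasiBasis E u v

open Classical in
/-- `Index E = ∑ᵢ uᵢ vᵢ` for a quasi-basis `(uᵢ, vᵢ)` of `E`; by `index_eq` it does not depend on
the quasi-basis. (The value is `0` if `E` is not of index-finite type.) -/
def index (E : A →L[ℂ] P) : A :=
  if h : IsIndexFinite E then
    ∑ i, h.choose_spec.choose i * h.choose_spec.choose_spec.choose i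
  else 0

theorem IsQuasiBasis.sum_eq {E : A →L[ℂ] P} {m n : ℕ} {u v : Fin n → A} {u' v' : Fin m → A}
    (h : IsQuasiBasis E u v) (h' : IsQuasiBasis E u' v') :
    ∑ i, u i * v i = ∑ j, u' j * v' j := by
  calc ∑ i, u i * v i = ∑ i, u i * ∑ j, (E (v i * u' j) : A) * v' j := by
        simp_rw [(h' _).2]
    _ = ∑ j, (∑ i, u i * (E (v i * u' j) : A)) * v' j := by
        simp_rw [Finset.mul_sum, Finset.sum_mul, mul_assoc]
        exact Finset.sum_comm
    _ = ∑ j, u' j * v' j := by simp_rw [(h _).1]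

theorem index_eq {E : A →L[ℂ] P} {n : ℕ} {u v : Fin n → A} (h : IsQuasiBasis E u v) :
    index E = ∑ i, u i * v i := by
  have hE : IsIndexFinite E := ⟨n, u, v, h⟩
  rw [index, dif_pos hE]
  exact IsQuasiBasis.sum_eq hE.choose_spec.choose_spec.choose_spec h

/-- `E` regarded as a map `A → A` with values in `P`. -/
def toSelfMap (E : A →L[ℂ] P) : A →L[ℂ] A :=
  (Submodule.subtypeL P.toSubalgebra.toSubmodule).comp E

theorem toSelfMap_apply (E : A →L[ℂ] P) (a : A) : toSelfMap E a = (E a : A) := rfl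

/-- The tracial Rokhlin property of `E` (of index-finite type). For every nonzero positive `z` in
`A^∞` there is a projection `e` in `A' ∩ A^∞` such that `g = (Index E) E^∞(e)` is a projection,
`1 - g` is Murray–von Neumann equivalent to a projection in the hereditary subalgebra of `A^∞`
generated by `z`, which is the closure of `z A^∞ z`, and the map `x ↦ x e` is injective on `A`.
Here `E^∞` is regarded as a map `A^∞ → A^∞`. -/
def HasTracialRokhlinProperty (E : A →L[ℂ] P) : Prop :=
  ∀ z : SeqAlg A, z ≠ 0 → (∃ y, z = star y * y) →
    ∃ e : SeqAlg A, IsStarProjection e ∧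
      (∀ a : A, SeqAlg.const a * e = e * SeqAlg.const a) ∧
      IsStarProjection (SeqAlg.const (index E) * SeqAlg.map (toSelfMap E) e) ∧
      (∃ r : SeqAlg A, IsStarProjection r ∧
        r ∈ closure (Set.range fun x => z * x * z) ∧
        MvNEquiv (1 - SeqAlg.const (index E) * SeqAlg.map (toSelfMap E) e) r) ∧
      Function.Injective fun a : A => SeqAlg.const a * e

end ConditionalExpectation

end

/-! ### Preliminaries on C*-algebras -/

section CStar

variable {B : Type*} [CStarAlgebra B]

/-! `Index E` is central, hence a scalar `l > 0` because `A` is simple. Let `e` be a projection as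
in the tracial Rokhlin property and `g = l • E^∞(e)`. The key identity is `l • (e * E^∞(e * x)) = e
* x` on `A^∞` (`IsRokhlinProjection.smul_mul_expInf`). It makes `φ(a) = l • E^∞(a e)` a
*-homomorphism from `A` to `P^∞` with `φ(b) = b g` for `b` in `P`, so comparisons in `A` pass to
`P^∞`, up to the corner `1 - g`. The same identity shows that `√l • E^∞` carries `v` with `e v = v`
to an element whose square is `E^∞(v* v)`. Hence for each nonzero `z` in `P` the projection `e` can
be chosen with `1 - g` close to `(z x)* (z x)` for some `x` in `P^∞`
(`HasTracialRokhlinProperty.exists_isRokhlinProjection`).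

Let `p`, `q` over `P` satisfy `τ(p) < τ(q)` for all traces of `P`. Traces of `A` restrict to `P`, so
`p ≾ q` over `A`. If some `g` is `1`, then `φ` moves this comparison to `P^∞`, and a late term of a
representing sequence, corrected by functional calculus, gives it over `P`.

If no `g` is `1`, then room for `1 - g` must be reserved under `q`. In this case every nonzero right
ideal `bP` contains arbitrarily many orthogonal copies of some nonzero projection `t`
(`IsRokhlinInclusion.exists_projection_copies`), and many copies force `τ(t)` to be small. The gap
`τ(q) - τ(p)` is bounded below uniformly in `τ` (`exists_trace_gap`), so `n` copies of `t`,
assembled in a matrix `Y` with `q Y = Y`, can be removed from `q`, leaving `r` with `τ(p) < τ(r)`.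
Let `y` over `A` carry `p` under `r`, and let `V` in `P^∞` carry `1 - g` approximately under `t`.
Then `Z = φ(y) + Y V p` has `Z* q Z` close to `p g + p (1 - g) = p`
(`IsRokhlinInclusion.mvNSubequiv`). -/

theorem isUnit_of_norm_sub_one_lt_one {a : B} (h : ‖a - 1‖ < 1) : IsUnit a := by
  have := (Units.oneSub (1 - a) (by rwa [norm_sub_rev])).isUnit
  simpa using this

section Order

attribute [local instance] CStarAlgebra.spectralOrder CStarAlgebra.spectralOrderedRing

theorem norm_sq_le_norm_sum_star_mul_self {ι : Type*} (s : Finset ι) (x : ι → B) {i : ι}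
    (hi : i ∈ s) : ‖x i‖ ^ 2 ≤ ‖∑ j ∈ s, star (x j) * x j‖ := by
  rw [sq, ← CStarRing.norm_star_mul_self]
  refine CStarAlgebra.norm_le_norm_of_nonneg_of_le (star_mul_self_nonneg _) ?_
  exact Finset.single_le_sum (f := fun j => star (x j) * x j)
    (fun j _ => star_mul_self_nonneg _) hi

theorem exists_star_mul_self_sqrt (a : B) :
    ∃ d : B, star d = d ∧ d * d = star a * a := by
  have h : 0 ≤ star a * a := star_mul_self_nonneg a
  exact ⟨CFC.sqrt (star a * a), (CFC.sqrt_nonneg _).isSelfAdjoint, CFC.sqrt_mul_sqrt_self _ h⟩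

/-- The complement in `‖x‖² · 1` of `x* x` is positive. -/
theorem exists_norm_sq_smul_one_sub (x : B) :
    ∃ d : B, ((‖x‖ ^ 2 : ℝ) : ℂ) • (1 : B) - star x * x = star d * d := by
  have h : star x * x ≤ algebraMap ℝ B (‖x‖ ^ 2) := CStarAlgebra.star_mul_le_algebraMap_norm_sq
  rw [← sub_nonneg, CStarAlgebra.nonneg_iff_eq_star_mul_self] at h
  obtain ⟨d, hd⟩ := h
  refine ⟨d, ?_⟩
  rw [← hd, Algebra.algebraMap_eq_smul_one, Complex.coe_smul]

/-- A positive element near `1` has an inverse square root commuting with its commutant. -/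
theorem exists_inv_sqrt {c y z : B} (hc : c = star y * y + star z * z) (h1 : ‖c - 1‖ < 1) :
    ∃ d : B, star d = d ∧ d * c * d = 1 ∧ ∀ x, Commute c x → Commute d x := by
  have h0 : 0 ≤ c := by
    rw [hc]; exact add_nonneg (star_mul_self_nonneg _) (star_mul_self_nonneg _)
  have hu := isUnit_of_norm_sub_one_lt_one h1
  have hsa : IsSelfAdjoint c := h0.isSelfAdjoint
  have hpos : ∀ t ∈ spectrum ℝ c, 0 < t := fun t ht =>
    lt_of_le_of_ne (spectrum_nonneg_of_nonneg h0 ht) (by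
      rintro rfl; exact spectrum.zero_notMem ℝ hu ht)
  set f : ℝ → ℝ := fun t => (Real.sqrt t)⁻¹ with hf
  have hcont : ContinuousOn f (spectrum ℝ c) :=
    ContinuousOn.inv₀ (by fun_prop) fun t ht => (Real.sqrt_pos.2 (hpos t ht)).ne'
  refine ⟨cfc f c, IsSelfAdjoint.star_eq (cfc_predicate f c), ?_, fun x hx => hx.cfc_real f⟩
  have key : cfc f c * c * cfc f c = cfc (fun t : ℝ => f t * t * f t) c := by
    rw [cfc_mul _ _ c, cfc_mul _ _ c, cfc_id' ℝ c]
  rw [key, ← cfc_one ℝ c]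
  refine cfc_congr fun t ht => ?_
  have h := Real.sqrt_pos.2 (hpos t ht)
  have h2 := Real.mul_self_sqrt (hpos t ht).le
  simp only [Pi.one_apply, hf]
  field_simp
  nlinarith

/-- Negative part of a self-adjoint element, in terms of squares. -/
theorem exists_negPart_witness {N : B} (hN : star N = N) :
    ∃ b y : B, star b = b ∧ b * N * b = -(star y * y) ∧ (y = 0 → ∃ c, N = c * star c) := by
  have hsa : IsSelfAdjoint N := hN
  have hb0 : 0 ≤ N⁻ := CFC.negPart_nonneg N
  have hs : star (CFC.sqrt N⁻) = CFC.sqrt N⁻ := (CFC.sqrt_nonneg _).isSelfAdjoint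
  have hss : CFC.sqrt N⁻ * CFC.sqrt N⁻ = N⁻ := CFC.sqrt_mul_sqrt_self _ hb0
  have hbs : star N⁻ = N⁻ := hb0.isSelfAdjoint
  have hdec : N⁺ - N⁻ = N := CFC.posPart_sub_negPart N
  have hmul : N⁻ * N⁺ = 0 := CFC.negPart_mul_posPart N
  -- Since `N⁻ N⁺ = 0`, compressing `N` by `N⁻` leaves `-(N⁻)³`.
  refine ⟨N⁻, CFC.sqrt N⁻ * N⁻, hbs, ?_, fun h => ?_⟩
  · conv_lhs => enter [1, 2]; rw [← hdec]
    rw [mul_sub, hmul, star_mul, hbs, hs]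
    calc (0 - N⁻ * N⁻) * N⁻ = -(N⁻ * N⁻ * N⁻) := by noncomm_ring
      _ = -(N⁻ * (CFC.sqrt N⁻ * CFC.sqrt N⁻) * N⁻) := by rw [hss]
      _ = _ := by noncomm_ring
  · have h1 : star N⁻ * N⁻ = 0 := by
      rw [hbs]; nth_rewrite 1 [← hss]; rw [mul_assoc, h, mul_zero]
    have h2 : N⁻ = 0 := CStarRing.star_mul_self_eq_zero_iff _ |>.1 h1
    refine ⟨CFC.sqrt N⁺, ?_⟩
    rw [(CFC.sqrt_nonneg N⁺).isSelfAdjoint.star_eq,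
      CFC.sqrt_mul_sqrt_self _ (CFC.posPart_nonneg N)]
    nth_rewrite 1 [← hdec]
    rw [h2, sub_zero]

/-- Orthogonal decomposition of a self-adjoint element. -/
theorem exists_orthogonal_of_isSelfAdjoint {d : B} (hd : star d = d) :
    ∃ x₁ x₂ : B, star (d * x₁) = d * x₁ ∧ star (d * x₂) = d * x₂ ∧
      (d * x₁) * (d * x₂) = 0 ∧ (d * x₁ = 0 → ∃ c, d = -(star c * c)) ∧
      (d * x₂ = 0 → ∃ c, d = star c * c) := by
  have hsa : IsSelfAdjoint d := hd
  have hp0 : 0 ≤ d⁺ := CFC.posPart_nonneg d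
  have hb0 : 0 ≤ d⁻ := CFC.negPart_nonneg d
  have hps : star d⁺ = d⁺ := hp0.isSelfAdjoint
  have hbs : star d⁻ = d⁻ := hb0.isSelfAdjoint
  have hdec : d⁺ - d⁻ = d := CFC.posPart_sub_negPart d
  have hnp : d⁻ * d⁺ = 0 := CFC.negPart_mul_posPart d
  have hpn : d⁺ * d⁻ = 0 := CFC.posPart_mul_negPart d
  have e1 : d * d⁺ = star d⁺ * d⁺ := by
    nth_rewrite 1 [← hdec]; rw [sub_mul, hnp, sub_zero, hps]
  have e2 : d * (-d⁻) = star d⁻ * d⁻ := by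
    nth_rewrite 1 [← hdec]; rw [mul_neg, sub_mul, hpn, zero_sub, neg_neg, hbs]
  -- With these choices `d x₁ = (d⁺)²` and `d x₂ = (d⁻)²`.
  refine ⟨d⁺, -d⁻, ?_, ?_, ?_, fun h => ?_, fun h => ?_⟩
  · rw [e1, star_mul, star_star]
  · rw [e2, star_mul, star_star]
  · rw [e1, e2, hps, hbs, mul_assoc, ← mul_assoc d⁺ d⁻, hpn, zero_mul, mul_zero]
  · rw [e1, CStarRing.star_mul_self_eq_zero_iff] at h
    obtain ⟨c, hc⟩ := CStarAlgebra.nonneg_iff_eq_star_mul_self.1 hb0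
    exact ⟨c, by rw [← hc]; nth_rewrite 1 [← hdec]; rw [h, zero_sub]⟩
  · rw [e2, CStarRing.star_mul_self_eq_zero_iff] at h
    obtain ⟨c, hc⟩ := CStarAlgebra.nonneg_iff_eq_star_mul_self.1 hp0
    exact ⟨c, by rw [← hc]; nth_rewrite 1 [← hdec]; rw [h, sub_zero]⟩

/-- An element `y` for which `y* y` is nearly a nonzero projection can be multiplied on the right
to a nonzero partial isometry. -/
theorem exists_isStarProjection_of_near {y : B}
    (h1 : ‖(star y * y) * (star y * y) - star y * y‖ < 1 / 4)
    (h2 : 1 / 2 < ‖star y * y‖) :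
    ∃ x : B, IsStarProjection (star (y * x) * (y * x)) ∧ y * x ≠ 0 := by
  set d := star y * y with hd
  have h0 : 0 ≤ d := star_mul_self_nonneg y
  have hsa : IsSelfAdjoint d := h0.isSelfAdjoint
  have : Nontrivial B := by
    refine ⟨d, 0, fun h => ?_⟩
    rw [h, norm_zero] at h2; norm_num at h2
  have hgap : ∀ t ∈ spectrum ℝ d, |t * t - t| < 1 / 4 := by
    intro t ht
    have hsp : t * t - t ∈ spectrum ℝ (d * d - d) := by
      have e : d * d - d = cfc (fun t : ℝ => t * t - t) d := by
        rw [cfc_sub _ _ d, cfc_mul _ _ d, cfc_id' ℝ d]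
      rw [e, cfc_map_spectrum (R := ℝ) _ d]
      exact ⟨t, ht, rfl⟩
    calc |t * t - t| = ‖t * t - t‖ := rfl
      _ ≤ ‖d * d - d‖ := spectrum.norm_le_norm_of_mem hsp
      _ < _ := h1
  -- `|t² - t|` equals `1/4` at `t = 1/2`, so the spectrum misses the jump of `f` below.
  have hne : ∀ t ∈ spectrum ℝ d, t ≠ 1 / 2 := by
    rintro t ht rfl
    have := hgap _ ht
    norm_num at this
  set f : ℝ → ℝ := fun t => if 1 / 2 < t then (Real.sqrt t)⁻¹ else 0 with hf
  have hcont : ContinuousOn f (spectrum ℝ d) := by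
    intro t ht
    apply ContinuousAt.continuousWithinAt
    rcases lt_or_gt_of_ne (hne t ht) with h | h
    · refine (continuousAt_const (y := (0 : ℝ))).congr ?_
      filter_upwards [eventually_lt_nhds h] with u hu
      exact (if_neg (not_lt.2 hu.le)).symm
    · have hc : ContinuousAt (fun u : ℝ => (Real.sqrt u)⁻¹) t :=
        ContinuousAt.inv₀ (by fun_prop) (Real.sqrt_pos.2 (by linarith)).ne'
      refine hc.congr ?_
      filter_upwards [eventually_gt_nhds h] with u hu
      exact (if_pos hu).symm
  have hfs : star (cfc f d) = cfc f d := cfc_predicate f d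
  have key : star (y * cfc f d) * (y * cfc f d)
      = cfc (fun t : ℝ => f t * t * f t) d := by
    rw [cfc_mul _ _ d, cfc_mul _ _ d, cfc_id' ℝ d, star_mul, hfs, hd]
    simp only [mul_assoc]
  have hval : ∀ t, f t * t * f t = if 1 / 2 < t then 1 else 0 := by
    intro t
    simp only [hf]
    split_ifs with h
    · have h3 := Real.sqrt_pos.2 (show (0 : ℝ) < t by linarith)
      have h4 := Real.mul_self_sqrt (show (0 : ℝ) ≤ t by linarith)
      field_simp
      nlinarith
    · simp
  refine ⟨cfc f d, ⟨?_, ?_⟩, fun h => ?_⟩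
  · rw [key, IsIdempotentElem, ← cfc_mul _ _ d]
    refine cfc_congr fun t _ => ?_
    simp only [hval]; split_ifs <;> simp
  · exact IsSelfAdjoint.star_mul_self _
  · rw [h, mul_zero] at key
    have h3 : (fun t : ℝ => f t * t * f t) ‖d‖ ∈
        spectrum ℝ (cfc (fun t : ℝ => f t * t * f t) d) := by
      rw [cfc_map_spectrum (R := ℝ) _ d]
      exact ⟨_, CStarAlgebra.norm_mem_spectrum_of_nonneg h0, rfl⟩
    rw [← key] at h3
    simp only [hval, h2, if_true, spectrum.zero_eq, Set.mem_singleton_iff, one_ne_zero] at h3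

end Order

/-- For projections, `p ≾ q` as soon as `y* q y` is within distance `1` of `p`. -/
theorem mvNSubequiv_of_norm_lt_one {p q y : B} (hp : IsStarProjection p) (hq : IsStarProjection q)
    (h : ‖star y * q * y - p‖ < 1) : MvNSubequiv p q := by
  have hpp : p * p = p := hp.isIdempotentElem
  have hps : star p = p := hp.isSelfAdjoint
  have hqq : q * q = q := hq.isIdempotentElem
  have hqs : star q = q := hq.isSelfAdjoint
  have hp1 : ‖p‖ ≤ 1 := hp.norm_le
  -- The summand `1 - p` makes `c` invertible. As `c` commutes with `p`, so does `c^(-1/2)`, and `q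
  -- y p c^(-1/2)` is the required partial isometry.
  set c := p * (star y * q * y) * p + (1 - p) with hc
  have hc' : c = star (q * y * p) * (q * y * p) + star (1 - p) * (1 - p) := by
    simp only [star_mul, star_sub, star_one, hps, hqs, hc]
    have e1 : (1 - p) * (1 - p) = 1 - p := by
      calc (1 - p) * (1 - p) = 1 - p - p + p * p := by noncomm_ring
        _ = _ := by rw [hpp]; abel
    rw [e1]
    congr 1
    calc p * (star y * q * y) * p = p * (star y * (q * q) * y) * p := by rw [hqq]
      _ = _ := by simp only [mul_assoc]
  have hc1 : ‖c - 1‖ < 1 := by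
    have e : c - 1 = p * (star y * q * y - p) * p := by
      rw [hc, mul_sub, sub_mul, hpp, hpp]; abel
    rw [e]
    calc ‖p * (star y * q * y - p) * p‖ ≤ ‖p‖ * ‖star y * q * y - p‖ * ‖p‖ := norm_mul₃_le
      _ ≤ 1 * ‖star y * q * y - p‖ * 1 := by gcongr
      _ < 1 := by simpa using h
  obtain ⟨d, hds, hdc, hcomm⟩ := exists_inv_sqrt hc' hc1
  have hpc : p * c = p * (star y * q * y) * p := by
    rw [hc, mul_add, mul_sub, mul_one, hpp, sub_self, add_zero]
    simp only [← mul_assoc, hpp]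
  have hcp : c * p = p * (star y * q * y) * p := by
    rw [hc, add_mul, sub_mul, one_mul, hpp, sub_self, add_zero]
    simp only [mul_assoc, hpp]
  have hdp : d * p = p * d := hcomm p (hcp.trans hpc.symm)
  set w := q * y * p * d with hw
  have hww : star w * w = p := by
    have : star w * w = d * (p * (star y * (q * q) * y) * p) * d := by
      simp only [hw, star_mul, hds, hps, hqs, mul_assoc]
    rw [this, hqq, ← hpc, ← mul_assoc, hdp, mul_assoc p, mul_assoc p, hdc, mul_one]
  have hwp : w * p = w := by
    rw [hw, mul_assoc, hdp, ← mul_assoc, mul_assoc (q * y) p p, hpp]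
  refine ⟨w * star w, ⟨?_, IsSelfAdjoint.mul_star_self _⟩, ?_, w, hww, rfl⟩
  · change w * star w * (w * star w) = w * star w
    rw [mul_assoc, ← mul_assoc (star w), hww, ← mul_assoc, hwp]
  · simp only [hw, ← mul_assoc, hqq]

end CStar

/-! ### Matrices over C*-algebras -/

section Matrices

variable {B : Type*} [CStarAlgebra B]

section Order

attribute [local instance] CStarAlgebra.spectralOrder CStarAlgebra.spectralOrderedRing

/-- Small entries make a matrix of small operator norm. -/
theorem exists_pos_norm_ofMatrix_lt (B : Type*) [CStarAlgebra B] (n : ℕ) {ε : ℝ} (hε : 0 < ε) :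
    ∃ δ > 0, ∀ M : Matrix (Fin n) (Fin n) B, (∀ i j, ‖M i j‖ < δ) →
      ‖CStarMatrix.ofMatrix M‖ < ε := by
  have h : Tendsto (fun M : CStarMatrix (Fin n) (Fin n) B => ‖M‖) (𝓝 0) (𝓝 0) := by
    simpa using (continuous_norm (E := CStarMatrix (Fin n) (Fin n) B)).tendsto 0
  -- The topology of the C*-norm on matrices is the entrywise one.
  have h2 : ∀ᶠ M : Fin n → Fin n → B in 𝓝 0, ‖CStarMatrix.ofMatrix (Matrix.of M)‖ < ε :=
    h.eventually (eventually_lt_nhds hε)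
  obtain ⟨δ, hδ, H⟩ := Metric.eventually_nhds_iff.1 h2
  refine ⟨δ, hδ, fun M hM => H (y := fun i j => M i j) ?_⟩
  rw [dist_pi_lt_iff hδ]
  intro i
  rw [dist_pi_lt_iff hδ]
  intro j
  simpa using hM i j

/-- Murray–von Neumann comparison of projections in `Mₙ(B)` from an entrywise estimate. -/
theorem exists_pos_mvNSubequiv_matrix (B : Type*) [CStarAlgebra B] (n : ℕ) :
    ∃ δ > 0, ∀ p q y : Matrix (Fin n) (Fin n) B, IsStarProjection p → IsStarProjection q →
      (∀ i j, ‖(star y * q * y - p) i j‖ < δ) → MvNSubequiv p q := by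
  obtain ⟨δ, hδ, H⟩ := exists_pos_norm_ofMatrix_lt B n one_pos
  refine ⟨δ, hδ, fun p q y hp hq h => ?_⟩
  have := mvNSubequiv_of_norm_lt_one (B := CStarMatrix (Fin n) (Fin n) B)
    (p := CStarMatrix.ofMatrix p) (q := CStarMatrix.ofMatrix q) (y := CStarMatrix.ofMatrix y)
    ⟨hp.1, hp.2⟩ ⟨hq.1, hq.2⟩ (H _ h)
  obtain ⟨r, hr, hqr, v, hv⟩ := this
  exact ⟨r, ⟨hr.1, hr.2⟩, hqr, v, hv⟩

/-- A self-adjoint matrix with positive quadratic form factors as `c c*`. -/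
theorem exists_eq_mul_star_of_quadratic_form {n : ℕ} (N : Matrix (Fin n) (Fin n) B)
    (hN : star N = N)
    (h : ∀ b : Fin n → B, ∃ β : B, ∑ j, ∑ k, star (b j) * N j k * b k = star β * β) :
    ∃ c : Matrix (Fin n) (Fin n) B, N = c * star c := by
  obtain ⟨b, y, hb, hy, H⟩ := exists_negPart_witness (B := CStarMatrix (Fin n) (Fin n) B)
    (N := CStarMatrix.ofMatrix N) hN
  let b' : Matrix (Fin n) (Fin n) B := CStarMatrix.ofMatrix.symm b
  let y' : Matrix (Fin n) (Fin n) B := CStarMatrix.ofMatrix.symm y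
  have hb' : star b' = b' := hb
  have hy' : b' * N * b' = -(star y' * y') := hy
  -- A diagonal entry of `b' N b'` is a value of the quadratic form, hence a square, and is also
  -- minus a sum of squares of entries of `y'`; all of these vanish.
  have hy0 : y' = 0 := by
    ext k i
    obtain ⟨β, hβ⟩ := h fun j => b' j i
    have e1 : (b' * N * b') i i = star β * β := by
      rw [← hβ]
      conv_lhs => enter [1, 1]; rw [← hb']
      simp only [Matrix.mul_apply, Matrix.star_apply, Finset.sum_mul]
      exact Finset.sum_comm
    have e2 : star β * β + ∑ k, star (y' k i) * y' k i = 0 := by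
      rw [← e1, hy']
      simp [Matrix.mul_apply, Matrix.star_apply]
    let f : Option (Fin n) → B := fun o => o.elim β fun k => y' k i
    have e3 : ∑ o, star (f o) * f o = 0 := by
      rw [Fintype.sum_option]; exact e2
    have e4 := norm_sq_le_norm_sum_star_mul_self Finset.univ f (Finset.mem_univ (some k))
    rw [e3, norm_zero] at e4
    have : ‖f (some k)‖ = 0 := by nlinarith [norm_nonneg (f (some k))]
    simpa [f] using this
  obtain ⟨c, hc⟩ := H hy0
  exact ⟨c, hc⟩

end Order

end Matrices

/-! ### Simplicity -/

section Simple

variable {B : Type*} [CStarAlgebra B]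

/-- Every nonzero element generates `1` algebraically as a two-sided ideal. -/
def IsAlgebraicallySimple (B : Type*) [Ring B] : Prop :=
  ∀ a : B, a ≠ 0 → ∃ (m : ℕ) (x y : Fin m → B), ∑ i, x i * a * y i = 1

theorem exists_sum_eq_one_of_norm_lt {a : B} {m : ℕ} {x y : Fin m → B}
    (h : ‖∑ i, x i * a * y i - 1‖ < 1) :
    ∃ (m : ℕ) (x y : Fin m → B), ∑ i, x i * a * y i = 1 := by
  obtain ⟨u, hu⟩ := isUnit_of_norm_sub_one_lt_one h
  refine ⟨m, fun i => ↑u⁻¹ * x i, y, ?_⟩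
  simp only [mul_assoc, ← Finset.mul_sum] at hu ⊢
  rw [← hu, Units.inv_mul]

/-- The closed ideal generated by `a` contains `1`, so the algebraic ideal has an element at
distance less than `1` from `1`. That element is invertible, and its inverse is absorbed by the left
factors. -/
theorem IsSimpleCStarAlgebra.isAlgebraicallySimple (h : IsSimpleCStarAlgebra B) :
    IsAlgebraicallySimple B := by
  intro a ha
  let S : AddSubgroup B :=
    { carrier := {b | ∃ (m : ℕ) (x y : Fin m → B), ∑ i, x i * a * y i = b}
      zero_mem' := ⟨0, Fin.elim0, Fin.elim0, by simp⟩
      add_mem' := by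
        rintro _ _ ⟨m, x, y, rfl⟩ ⟨m', x', y', rfl⟩
        exact ⟨m + m', Fin.append x x', Fin.append y y', by simp [Fin.sum_univ_add]⟩
      neg_mem' := by
        rintro _ ⟨m, x, y, rfl⟩
        exact ⟨m, fun i => -x i, y, by simp⟩ }
  have hl : ∀ c b, b ∈ S → c * b ∈ S := by
    rintro c _ ⟨m, x, y, rfl⟩
    exact ⟨m, fun i => c * x i, y, by simp [Finset.mul_sum, mul_assoc]⟩
  have hr : ∀ c b, b ∈ S → b * c ∈ S := by
    rintro c _ ⟨m, x, y, rfl⟩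
    exact ⟨m, x, fun i => y i * c, by simp [Finset.sum_mul, mul_assoc]⟩
  let I : TwoSidedIdeal B := TwoSidedIdeal.mk' (S.topologicalClosure : Set B)
    S.topologicalClosure.zero_mem S.topologicalClosure.add_mem S.topologicalClosure.neg_mem
    (fun {c b} hb => map_mem_closure (continuous_const_mul c) hb (hl c))
    (fun {b c} hb => map_mem_closure (f := fun t => t * c) (continuous_mul_const c) hb (hr c))
  have hI : (I : Set B) = closure (S : Set B) := by
    ext b; exact TwoSidedIdeal.mem_mk' ..
  have haI : a ∈ I := by
    rw [← SetLike.mem_coe, hI]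
    exact subset_closure ⟨1, fun _ => 1, fun _ => 1, by simp⟩
  rcases h.2 I (by rw [hI]; exact isClosed_closure) with h0 | h1
  · rw [h0, TwoSidedIdeal.mem_bot] at haI
    exact absurd haI ha
  · have h1I : (1 : B) ∈ closure (S : Set B) := by
      rw [← hI, h1]; exact TwoSidedIdeal.mem_top _
    obtain ⟨_, ⟨m, x, y, rfl⟩, hd⟩ := Metric.mem_closure_iff.1 h1I 1 one_pos
    rw [dist_comm, dist_eq_norm] at hd
    exact exists_sum_eq_one_of_norm_lt hd

/-- Algebraically simple rings are prime. -/
theorem IsAlgebraicallySimple.exists_mul_mul_ne_zero {B : Type*} [Ring B]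
    (h : IsAlgebraicallySimple B) {a b : B} (ha : a ≠ 0) (hb : b ≠ 0) : ∃ y, a * y * b ≠ 0 := by
  by_contra! H
  obtain ⟨m, x, y, hxy⟩ := h b hb
  apply ha
  rw [← mul_one a, ← hxy, Finset.mul_sum]
  refine Finset.sum_eq_zero fun i _ => ?_
  rw [← mul_assoc, ← mul_assoc, H, zero_mul]

/-- Central elements of a simple unital C*-algebra are scalars. -/
theorem IsAlgebraicallySimple.exists_eq_algebraMap [Nontrivial B] (h : IsAlgebraicallySimple B)
    {c : B} (hc : ∀ a, a * c = c * a) : ∃ μ : ℂ, c = algebraMap ℂ B μ := by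
  obtain ⟨μ, hμ⟩ := spectrum.nonempty (A := B) c
  refine ⟨μ, ?_⟩
  by_contra hne
  -- A nonzero central element of an algebraically simple ring is invertible, with inverse `∑ xᵢ
  -- yᵢ`; this contradicts `μ` lying in the spectrum.
  obtain ⟨m, x, y, hxy⟩ := h (algebraMap ℂ B μ - c) (sub_ne_zero.2 (Ne.symm hne))
  have hz : ∀ a, a * (algebraMap ℂ B μ - c) = (algebraMap ℂ B μ - c) * a := fun a => by
    rw [mul_sub, sub_mul, hc, Algebra.commutes μ a]
  apply hμ
  refine isUnit_iff_exists.2 ⟨∑ i, x i * y i, ?_, ?_⟩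
  · rw [← hxy, Finset.mul_sum]
    refine Finset.sum_congr rfl fun i _ => ?_
    rw [hz, mul_assoc]
  · rw [← hxy, Finset.sum_mul]
    refine Finset.sum_congr rfl fun i _ => ?_
    rw [mul_assoc, mul_assoc, hz]

end Simple

/-! ### Tracial states -/

section Traces

variable {B : Type*} [CStarAlgebra B]

theorem IsTracialState.re_nonneg {τ : B →ₗ[ℂ] ℂ} (h : IsTracialState τ) (b : B) :
    0 ≤ (τ (star b * b)).re := (Complex.le_def.1 (h.nonneg b)).1

/-- Writing `‖x‖² - x x*` as `d* d`, the inequality is positivity of `τ` on `(d c*)* (d c*)`, after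
cyclic permutation. -/
theorem IsTracialState.re_conj_le {τ : B →ₗ[ℂ] ℂ} (h : IsTracialState τ) (x c : B) :
    (τ (star x * (star c * c) * x)).re ≤ ‖x‖ ^ 2 * (τ (star c * c)).re := by
  obtain ⟨d, hd⟩ := exists_norm_sq_smul_one_sub (star x)
  have e1 : τ (star x * (star c * c) * x) = τ (c * (x * star x) * star c) := by
    rw [show star x * (star c * c) * x = (star x * star c) * (c * x) by simp only [mul_assoc],
      h.trace]
    simp only [mul_assoc]
  have e2 : τ (star c * c) = τ (c * star c) := h.trace _ _
  have e3 : star (d * star c) * (d * star c)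
      = ((‖x‖ ^ 2 : ℝ) : ℂ) • (c * star c) - c * (x * star x) * star c := by
    rw [star_mul, star_star]
    calc c * star d * (d * star c) = c * (star d * d) * star c := by simp only [mul_assoc]
      _ = _ := by
        rw [← hd, norm_star, star_star, mul_sub, sub_mul, mul_smul_comm, smul_mul_assoc, mul_one]
  have := h.re_nonneg (d * star c)
  rw [e3, map_sub, map_smul, smul_eq_mul, Complex.sub_re, Complex.re_ofReal_mul] at this
  rw [e1, e2]
  linarith

/-- In a simple C*-algebra, tracial states are bounded below on a nonzero positive element. -/
theorem IsAlgebraicallySimple.exists_trace_lower_bound (h : IsAlgebraicallySimple B) {c : B}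
    (hc : c ≠ 0) : ∃ C : ℝ, 0 < C ∧ ∀ τ : B →ₗ[ℂ] ℂ, IsTracialState τ →
      1 ≤ C * (τ (star c * c)).re := by
  obtain ⟨m, x, y, hxy⟩ := h (star c * c) fun h0 =>
    hc ((CStarRing.star_mul_self_eq_zero_iff c).1 h0)
  -- The sum comes from `2 Re τ(x c*c y) ≤ (‖x‖² + ‖y‖²) τ(c*c)`, applied to each term of an
  -- expression of `1`; the extra `1` only secures positivity.
  refine ⟨1 + ∑ i, (‖x i‖ ^ 2 + ‖y i‖ ^ 2), by positivity, fun τ hτ => ?_⟩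
  have h0 := hτ.re_nonneg c
  have key : ∀ i, 2 * (τ (x i * (star c * c) * y i)).re
      ≤ (‖x i‖ ^ 2 + ‖y i‖ ^ 2) * (τ (star c * c)).re := by
    intro i
    have h1 := hτ.re_conj_le (star (x i)) c
    have h2 := hτ.re_conj_le (y i) c
    have h3 := hτ.re_nonneg (c * star (x i) - c * y i)
    -- The two cross terms have the same real part because `τ` is real on the square of `c x* + i c
    -- y`.
    have hsym : (τ (star (y i) * (star c * c) * star (x i))).re
        = (τ (x i * (star c * c) * y i)).re := by
      have p1 := hτ.nonneg (c * star (x i) + c * y i)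
      have p2 := hτ.nonneg (c * star (x i) + Complex.I • (c * y i))
      have p3 := hτ.nonneg (c * star (x i))
      have p4 := hτ.nonneg (c * y i)
      have q2 := (Complex.le_def.1 p2).2
      have q3 := (Complex.le_def.1 p3).2
      have q4 := (Complex.le_def.1 p4).2
      simp only [star_add, star_smul, star_mul, star_star, mul_add, add_mul, smul_mul_assoc,
        mul_smul_comm, map_add, map_smul, smul_eq_mul, Complex.add_im, Complex.mul_im,
        Complex.star_def, Complex.conj_I, Complex.I_re, Complex.I_im, Complex.zero_im,
        Complex.neg_re, Complex.neg_im, Complex.mul_re, ← mul_assoc] at q2 q3 q4 ⊢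
      linarith
    have e : star (c * star (x i) - c * y i) * (c * star (x i) - c * y i)
        = x i * (star c * c) * star (x i) + star (y i) * (star c * c) * y i
          - x i * (star c * c) * y i - star (y i) * (star c * c) * star (x i) := by
      simp only [star_sub, star_mul, star_star]; noncomm_ring
    rw [e, map_sub, map_sub, map_add, Complex.sub_re, Complex.sub_re, Complex.add_re, hsym] at h3
    rw [star_star, norm_star] at h1
    linarith
  have hs : 2 * ∑ i, (τ (x i * (star c * c) * y i)).re
      ≤ (∑ i, (‖x i‖ ^ 2 + ‖y i‖ ^ 2)) * (τ (star c * c)).re := by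
    rw [Finset.mul_sum, Finset.sum_mul]
    exact Finset.sum_le_sum fun i _ => key i
  have h1 : ∑ i, (τ (x i * (star c * c) * y i)).re = 1 := by
    rw [← Complex.re_sum, ← map_sum, hxy, hτ.map_one, Complex.one_re]
  rw [h1] at hs
  nlinarith

end Traces

/-! ### Norm and involution of the sequence algebra -/

namespace SeqAlg

variable {A : Type*} [CStarAlgebra A]

theorem mk_surjective : Function.Surjective (mk : (ℕ →ᵇ A) → SeqAlg A) :=
  Ideal.Quotient.mk_surjective

theorem mk_eq_zero {f : ℕ →ᵇ A} : mk f = 0 ↔ Tendsto f atTop (𝓝 0) :=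
  Ideal.Quotient.eq_zero_iff_mem

theorem mk_add (f g : ℕ →ᵇ A) : mk (f + g) = mk f + mk g := rfl

theorem mk_sub (f g : ℕ →ᵇ A) : mk (f - g) = mk f - mk g := rfl

theorem mk_mul (f g : ℕ →ᵇ A) : mk (f * g) = mk f * mk g := rfl

theorem mk_one : mk (1 : ℕ →ᵇ A) = 1 := rfl

theorem mk_smul (c : ℝ) (f : ℕ →ᵇ A) : mk (c • f) = c • mk f := rfl

theorem mk_sum {ι : Type*} (s : Finset ι) (f : ι → ℕ →ᵇ A) :
    mk (∑ i ∈ s, f i) = ∑ i ∈ s, mk (f i) :=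
  map_sum (Ideal.Quotient.mk (nullSeq A)) f s

theorem mk_congr {f g : ℕ →ᵇ A} (h : ∀ᶠ k in atTop, f k = g k) : mk f = mk g := by
  rw [← sub_eq_zero, ← mk_sub, mk_eq_zero]
  refine tendsto_const_nhds.congr' ?_
  filter_upwards [h] with k hk
  simp [hk]

/-- The embedding of `A` in `A^∞` as a ring homomorphism. -/
noncomputable def constHom : A →+* SeqAlg A where
  toFun := const
  map_one' := rfl
  map_mul' _ _ := rfl
  map_zero' := rfl
  map_add' _ _ := rfl

theorem const_mul (a b : A) : const (a * b) = const a * const b := rfl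

theorem const_add (a b : A) : const (a + b) = const a + const b := rfl

theorem const_sub (a b : A) : const (a - b) = const a - const b := rfl

theorem const_one : const (1 : A) = 1 := rfl

theorem const_zero : const (0 : A) = 0 := rfl

theorem const_smul (c : ℝ) (a : A) : const (c • a) = c • const a := rfl

theorem star_const (a : A) : star (const a) = const (star a) := rfl

theorem const_sum {ι : Type*} (s : Finset ι) (f : ι → A) :
    const (∑ i ∈ s, f i) = ∑ i ∈ s, const (f i) := map_sum constHom f s

theorem const_eq_zero {a : A} : const a = 0 ↔ a = 0 := by
  rw [const, mk_eq_zero]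
  exact tendsto_const_nhds_iff

instance : StarModule ℝ (SeqAlg A) where
  star_smul c x := by
    obtain ⟨f, rfl⟩ := mk_surjective x
    rw [← mk_smul, star_mk, star_mk, star_smul, mk_smul]

/-- Altering finitely many terms does not change the class. With `eventually_norm_lt` this
identifies the quotient norm as a limit superior and reduces estimates in `A^∞` to estimates in `A`.
-/
theorem norm_mk_le {f : ℕ →ᵇ A} {c : ℝ} (hc : 0 ≤ c) (h : ∀ᶠ k in atTop, ‖f k‖ ≤ c) :
    ‖mk f‖ ≤ c := by
  classical
  let g : ℕ →ᵇ A := BoundedContinuousFunction.ofNormedAddCommGroupDiscrete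
    (fun k => if ‖f k‖ ≤ c then f k else 0) c fun k => by
      split_ifs with hk
      · exact hk
      · simpa using hc
  have hg : mk f = mk g := mk_congr (by
    filter_upwards [h] with k hk
    change f k = if ‖f k‖ ≤ c then f k else 0
    rw [if_pos hk])
  rw [hg]
  refine (Submodule.Quotient.norm_mk_le (nullSeq A) g).trans ?_
  exact (BoundedContinuousFunction.norm_le hc).2 fun k => by
    change ‖if ‖f k‖ ≤ c then f k else 0‖ ≤ c
    split_ifs with hk
    · exact hk
    · simpa using hc

theorem eventually_norm_lt {f : ℕ →ᵇ A} {c : ℝ} (h : ‖mk f‖ < c) :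
    ∀ᶠ k in atTop, ‖f k‖ < c := by
  obtain ⟨g, hg, hgn⟩ := Submodule.Quotient.norm_mk_lt (R := ℕ →ᵇ A) (S := nullSeq A)
    (mk f) (ε := c - ‖mk f‖) (sub_pos.2 h)
  have hg' : mk g = mk f := hg
  rw [← sub_eq_zero, ← mk_sub, mk_eq_zero] at hg'
  have h1 : ‖g‖ < c := by linarith
  have h2 := (tendsto_norm_zero.comp hg').eventually (eventually_lt_nhds (sub_pos.2 h1))
  filter_upwards [h2] with k hk
  have h3 : ‖f k‖ ≤ ‖g k‖ + ‖(g - f) k‖ := by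
    have : f k = g k - (g - f) k := by simp
    rw [this]
    exact norm_sub_le _ _
  have h4 := g.norm_coe_le_norm k
  simp only [Function.comp_apply] at hk
  linarith

theorem norm_eq_zero_iff {x : SeqAlg A} : ‖x‖ = 0 ↔ x = 0 := by
  refine ⟨fun h => ?_, fun h => by rw [h, norm_zero]⟩
  obtain ⟨f, rfl⟩ := mk_surjective x
  rw [mk_eq_zero, tendsto_zero_iff_norm_tendsto_zero, Metric.tendsto_atTop']
  intro ε hε
  obtain ⟨N, hN⟩ := eventually_atTop.1 (eventually_norm_lt (f := f) (c := ε) (by rwa [h]))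
  exact ⟨N, fun k hk => by simpa using hN k hk.le⟩

theorem norm_mul_le (x y : SeqAlg A) : ‖x * y‖ ≤ ‖x‖ * ‖y‖ := by
  obtain ⟨f, rfl⟩ := mk_surjective x
  obtain ⟨g, rfl⟩ := mk_surjective y
  have key : ∀ δ > 0, ‖mk f * mk g‖ ≤ (‖mk f‖ + δ) * (‖mk g‖ + δ) := by
    intro δ hδ
    rw [← mk_mul]
    refine norm_mk_le (by positivity) ?_
    filter_upwards [eventually_norm_lt (lt_add_of_pos_right ‖mk f‖ hδ),
      eventually_norm_lt (lt_add_of_pos_right ‖mk g‖ hδ)] with k h1 h2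
    exact (_root_.norm_mul_le _ _).trans (by gcongr)
  have ht : Tendsto (fun δ : ℝ => (‖mk f‖ + δ) * (‖mk g‖ + δ)) (𝓝[>] 0)
      (𝓝 (‖mk f‖ * ‖mk g‖)) := by
    have : Continuous fun δ : ℝ => (‖mk f‖ + δ) * (‖mk g‖ + δ) := by fun_prop
    simpa using (this.tendsto 0).mono_left nhdsWithin_le_nhds
  exact ge_of_tendsto ht (eventually_mem_nhdsWithin.mono fun δ hδ => key δ hδ)

theorem norm_sq_le (x : SeqAlg A) : ‖x‖ ^ 2 ≤ ‖star x * x‖ := by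
  obtain ⟨f, rfl⟩ := mk_surjective x
  refine le_of_forall_gt fun c hc => ?_
  obtain ⟨c', h1, h2⟩ := exists_between hc
  have h0 : 0 ≤ c' := (norm_nonneg _).trans h1.le
  have h3 : ‖mk f‖ ≤ Real.sqrt c' := by
    refine norm_mk_le (Real.sqrt_nonneg _) ?_
    rw [star_mk, ← mk_mul] at h1
    filter_upwards [eventually_norm_lt h1] with k hk
    apply Real.le_sqrt_of_sq_le
    have : ‖star (f k) * f k‖ < c' := hk
    rw [CStarRing.norm_star_mul_self] at this
    nlinarith
  calc ‖mk f‖ ^ 2 ≤ Real.sqrt c' ^ 2 := by gcongr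
    _ = c' := Real.sq_sqrt h0
    _ < c := h2

theorem norm_star_le (x : SeqAlg A) : ‖star x‖ ≤ ‖x‖ := by
  have h1 := (norm_sq_le (star x)).trans (norm_mul_le _ _)
  rw [star_star] at h1
  rcases (norm_nonneg (star x)).eq_or_lt with h | h
  · rw [← h]; exact norm_nonneg _
  · nlinarith

theorem norm_le_one_of_isStarProjection {p : SeqAlg A} (hp : IsStarProjection p) : ‖p‖ ≤ 1 := by
  have h := norm_sq_le p
  rw [hp.isSelfAdjoint.star_eq, hp.isIdempotentElem.eq] at h
  nlinarith [norm_nonneg p]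

theorem one_le_norm_of_isStarProjection {p : SeqAlg A} (hp : IsStarProjection p) (h0 : p ≠ 0) :
    1 ≤ ‖p‖ := by
  have h := norm_mul_le p p
  rw [hp.isIdempotentElem.eq] at h
  have : 0 < ‖p‖ := lt_of_le_of_ne (norm_nonneg _) fun h => h0 (norm_eq_zero_iff.1 h.symm)
  nlinarith

theorem eq_zero_of_star_mul_self_eq_zero {x : SeqAlg A} (h : star x * x = 0) : x = 0 := by
  have := norm_sq_le x
  rw [h, norm_zero] at this
  exact norm_eq_zero_iff.1 (by nlinarith [norm_nonneg x])

theorem eq_zero_of_sum_star_mul_self_eq_zero {ι : Type*} {s : Finset ι} {x : ι → SeqAlg A}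
    (h : ∑ j ∈ s, star (x j) * x j = 0) {i : ι} (hi : i ∈ s) : x i = 0 := by
  choose f hf using fun j => mk_surjective (x j)
  have h1 : mk (∑ j ∈ s, star (f j) * f j) = 0 := by
    rw [mk_sum, ← h]
    refine Finset.sum_congr rfl fun j _ => ?_
    rw [mk_mul, ← star_mk, hf]
  rw [← hf, mk_eq_zero, tendsto_zero_iff_norm_tendsto_zero]
  rw [mk_eq_zero, tendsto_zero_iff_norm_tendsto_zero] at h1
  have h2 := (Real.continuous_sqrt.tendsto 0).comp h1
  rw [Real.sqrt_zero] at h2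
  refine squeeze_zero (fun k => norm_nonneg _) (fun k => ?_) h2
  apply Real.le_sqrt_of_sq_le
  have := norm_sq_le_norm_sum_star_mul_self s (fun j => f j k) hi
  simpa [BoundedContinuousFunction.coe_sum] using this

/-- If `v* v` is a projection, then `v` is a partial isometry. -/
theorem mul_star_mul_self_of_isStarProjection {v : SeqAlg A} (h : IsStarProjection (star v * v)) :
    v * star v * v = v := by
  rw [← sub_eq_zero]
  apply eq_zero_of_star_mul_self_eq_zero
  have h1 : star v * v * (star v * v) = star v * v := h.isIdempotentElem
  simp only [star_sub, star_mul, star_star]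
  calc (star v * (v * star v) - star v) * (v * star v * v - v)
      = (star v * v * (star v * v)) * (star v * v) - star v * v * (star v * v)
        - star v * v * (star v * v) + star v * v := by noncomm_ring
    _ = 0 := by rw [h1, h1]; abel

/-- The entrywise map as an additive homomorphism. -/
noncomputable def mapHom (T : A →L[ℂ] A) : SeqAlg A →+ SeqAlg A where
  toFun := map T
  map_zero' := by
    rw [show (0 : SeqAlg A) = mk 0 from rfl, map_mk, _root_.map_zero]
  map_add' x y := by
    obtain ⟨f, rfl⟩ := mk_surjective x
    obtain ⟨g, rfl⟩ := mk_surjective y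
    rw [← mk_add, map_mk, _root_.map_add, mk_add, map_mk, map_mk]

theorem mapHom_mk (T : A →L[ℂ] A) (f : ℕ →ᵇ A) :
    mapHom T (mk f) = mk (T.compLeftContinuousBounded ℕ f) := rfl

theorem mapHom_smul (T : A →L[ℂ] A) (c : ℝ) (x : SeqAlg A) :
    mapHom T (c • x) = c • mapHom T x := by
  obtain ⟨f, rfl⟩ := mk_surjective x
  rw [← mk_smul, mapHom_mk, mapHom_mk, ← mk_smul]
  congr 1
  ext k
  exact map_real_smul T T.continuous c (f k)

theorem norm_mapHom_le (T : A →L[ℂ] A) (x : SeqAlg A) : ‖mapHom T x‖ ≤ ‖T‖ * ‖x‖ := by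
  obtain ⟨f, rfl⟩ := mk_surjective x
  have key : ∀ δ > 0, ‖mapHom T (mk f)‖ ≤ ‖T‖ * (‖mk f‖ + δ) := by
    intro δ hδ
    refine norm_mk_le (by positivity) ?_
    filter_upwards [eventually_norm_lt (lt_add_of_pos_right ‖mk f‖ hδ)] with k h1
    exact (T.le_opNorm (f k)).trans (by gcongr)
  have ht : Tendsto (fun δ : ℝ => ‖T‖ * (‖mk f‖ + δ)) (𝓝[>] 0) (𝓝 (‖T‖ * ‖mk f‖)) := by
    have : Continuous fun δ : ℝ => ‖T‖ * (‖mk f‖ + δ) := by fun_prop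
    simpa using (this.tendsto 0).mono_left nhdsWithin_le_nhds
  exact ge_of_tendsto ht (eventually_mem_nhdsWithin.mono fun δ hδ => key δ hδ)

end SeqAlg

/-! ### Conditional expectations of finite index -/

section Expectation

variable {A : Type*} [CStarAlgebra A] {P : StarSubalgebra ℂ A} {E : A →L[ℂ] P}

/-- Positivity makes `E(x* x)` self-adjoint; polarization with `x = a + 1` and `x = a + i` gives the
rest. -/
theorem IsConditionalExpectation.map_star (hE : IsConditionalExpectation E) (a : A) :
    E (star a) = star (E a) := by
  have hsq : ∀ x : A, star (E (star x * x)) = E (star x * x) := fun x => by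
    obtain ⟨b, hb⟩ := hE.positive x
    rw [hb, star_mul, star_star]
  have h1 := hsq (a + 1)
  have h2 := hsq (a + Complex.I • 1)
  have h3 := hsq a
  have h4 : star (E (1 : A)) = E 1 := by simpa using hsq 1
  simp only [star_add, star_one, add_mul, mul_add, one_mul, mul_one, star_smul, smul_mul_assoc,
    mul_smul_comm, map_add, map_smul, h3, h4, Complex.star_def, Complex.conj_I,
    neg_mul, neg_smul, map_neg, star_neg, smul_add, smul_neg, neg_neg] at h1 h2
  have e1 : star (E (star a)) + star (E a) = E a + E (star a) := by
    have := sub_eq_zero.2 h1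
    rw [← sub_eq_zero, ← this]; abel
  have e2 : Complex.I • star (E (star a)) - Complex.I • star (E a)
      = Complex.I • E a - Complex.I • E (star a) := by
    have := sub_eq_zero.2 h2
    rw [← sub_eq_zero, ← neg_zero, ← this]; abel
  have e3 : star (E (star a)) - star (E a) = E a - E (star a) := by
    have := congrArg (fun x => (-Complex.I) • x) e2
    simpa only [smul_sub, smul_smul, neg_mul, Complex.I_mul_I, neg_neg, one_smul] using this
  have e4 : (2 : ℂ) • star (E a) = (2 : ℂ) • E (star a) := by
    rw [two_smul, two_smul]
    calc star (E a) + star (E a) = (star (E (star a)) + star (E a))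
          - (star (E (star a)) - star (E a)) := by abel
      _ = E (star a) + E (star a) := by rw [e1, e3]; abel
  exact (smul_right_injective P (two_ne_zero (α := ℂ)) e4).symm

/-- A conditional expectation of index-finite type has a quasi-basis of the form `(wᵢ, wᵢ*)`. -/
theorem IsConditionalExpectation.exists_isQuasiBasis_star (hE : IsConditionalExpectation E)
    (hP : IsClosed (P : Set A)) (hfin : IsIndexFinite E) :
    ∃ (n : ℕ) (w : Fin n → A), IsQuasiBasis E w fun i => star (w i) := by
  obtain ⟨n, u, v, huv⟩ := hfin
  have : IsClosed (P : Set A) := hP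
  -- The quadratic form of `N` at `b` is `E` of the square of `∑ vₖ* bₖ`, so `N = c c*`. Since `∑ⱼ
  -- uⱼ N j k = vₖ*`, taking `wᵢ = ∑ⱼ uⱼ c j i` turns `∑ wᵢ E(wᵢ* x)` into `∑ vₖ* E(uₖ* x)`, the
  -- adjoint form of the second quasi-basis identity.
  let N : Matrix (Fin n) (Fin n) P := Matrix.of fun j k => E (v j * star (v k))
  have hstar : ∀ x : A, ∑ k, star (v k) * (E (star (u k) * x) : A) = x := fun x => by
    have := congrArg star (huv (star x)).2
    simp only [star_sum, star_mul, star_star] at this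
    refine Eq.trans (Finset.sum_congr rfl fun k _ => ?_) this
    rw [← StarMemClass.coe_star, ← hE.map_star, star_mul, star_star]
  obtain ⟨c, hc⟩ := exists_eq_mul_star_of_quadratic_form N (by
      ext j k : 2
      rw [Matrix.star_apply]
      simp only [N, Matrix.of_apply]
      rw [← hE.map_star, star_mul, star_star]) (fun b => by
      obtain ⟨β, hβ⟩ := hE.positive (∑ k, star (v k) * (b k : A))
      refine ⟨β, ?_⟩
      rw [← hβ, star_sum, Finset.sum_mul_sum]
      simp only [map_sum]
      refine Finset.sum_congr rfl fun j _ => Finset.sum_congr rfl fun k _ => ?_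
      rw [star_mul, star_star, ← StarMemClass.coe_star,
        show ((star (b j) : P) : A) * v j * (star (v k) * (b k : A))
          = (star (b j) : P) * ((v j * star (v k)) * b k) by simp only [mul_assoc],
        hE.map_mul_left, hE.map_mul_right, mul_assoc]
      rfl)
  let w : Fin n → A := fun i => ∑ j, u j * (c j i : A)
  have hw : ∀ x, ∑ i, w i * (E (star (w i) * x) : A) = x := by
    intro x
    have e1 : ∀ i, E (star (w i) * x) = ∑ k, star (c k i) * E (star (u k) * x) := fun i => by
      simp only [w, star_sum, star_mul, Finset.sum_mul, map_sum]
      refine Finset.sum_congr rfl fun k _ => ?_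
      rw [← StarMemClass.coe_star, mul_assoc, hE.map_mul_left]
    calc ∑ i, w i * (E (star (w i) * x) : A)
        = ∑ i, ∑ j, ∑ k, u j * ((c j i * star (c k i) : P) : A) * (E (star (u k) * x) : A) := by
          refine Finset.sum_congr rfl fun i _ => ?_
          rw [e1]
          simp only [w, Finset.sum_mul, AddSubmonoidClass.coe_finsetSum, Finset.mul_sum,
            MulMemClass.coe_mul, mul_assoc]
          exact Finset.sum_comm
      _ = ∑ j, ∑ k, u j * (N j k : A) * (E (star (u k) * x) : A) := by
          rw [Finset.sum_comm]
          refine Finset.sum_congr rfl fun j _ => ?_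
          rw [Finset.sum_comm]
          refine Finset.sum_congr rfl fun k _ => ?_
          rw [hc, Matrix.mul_apply]
          simp only [AddSubmonoidClass.coe_finsetSum, Finset.mul_sum, Finset.sum_mul,
            Matrix.star_apply]
      _ = ∑ k, star (v k) * (E (star (u k) * x) : A) := by
          rw [Finset.sum_comm]
          refine Finset.sum_congr rfl fun k _ => ?_
          rw [← Finset.sum_mul]
          congr 1
          exact (huv (star (v k))).1
      _ = x := hstar x
  refine ⟨n, w, fun x => ⟨hw x, ?_⟩⟩
  have := congrArg star (hw (star x))
  simp only [star_sum, star_mul, star_star] at this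
  refine Eq.trans (Finset.sum_congr rfl fun k _ => ?_) this
  rw [← StarMemClass.coe_star, ← hE.map_star, star_mul, star_star, star_star]

/-- Over a simple algebra the index is a positive scalar. -/
theorem IsConditionalExpectation.exists_index_eq_smul (hE : IsConditionalExpectation E)
    (hP : IsClosed (P : Set A)) (hfin : IsIndexFinite E) [Nontrivial A]
    (hA : IsAlgebraicallySimple A) : ∃ l : ℝ, 0 < l ∧ index E = l • (1 : A) := by
  obtain ⟨n, w, hw⟩ := hE.exists_isQuasiBasis_star hP hfin
  have hc : ∀ a, a * index E = index E * a := fun a => by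
    rw [index_eq hw, Finset.mul_sum, Finset.sum_mul]
    calc ∑ i, a * (w i * star (w i))
        = ∑ i, (∑ j, w j * (E (star (w j) * (a * w i)) : A)) * star (w i) := by
          refine Finset.sum_congr rfl fun i _ => ?_
          rw [(hw _).1, mul_assoc]
      _ = ∑ j, w j * ∑ i, (E ((star (w j) * a) * w i) : A) * star (w i) := by
          simp only [Finset.sum_mul, Finset.mul_sum, mul_assoc]
          exact Finset.sum_comm
      _ = ∑ j, w j * star (w j) * a := by
          refine Finset.sum_congr rfl fun j _ => ?_
          rw [(hw _).2, mul_assoc]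
  obtain ⟨μ, hμ⟩ := hA.exists_eq_algebraMap hc
  have hex : ∃ i, w i ≠ 0 := by
    by_contra! h
    have := (hw 1).1
    simp [h] at this
  obtain ⟨i, hi⟩ := hex
  let := CStarAlgebra.spectralOrder A
  have := CStarAlgebra.spectralOrderedRing A
  have h0 : 0 ≤ index E := by
    rw [index_eq hw]
    exact Finset.sum_nonneg fun j _ => mul_star_self_nonneg _
  have hne : index E ≠ 0 := fun h => by
    have h1 := norm_sq_le_norm_sum_star_mul_self Finset.univ (fun j => star (w j))
      (Finset.mem_univ i)
    simp only [star_star] at h1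
    rw [← index_eq hw, h, norm_zero, norm_star] at h1
    have : 0 < ‖w i‖ := norm_pos_iff.2 hi
    nlinarith
  have hsp : μ ∈ spectrum ℂ (index E) := by
    rw [hμ, spectrum.scalar_eq]; rfl
  have hμ0 : 0 ≤ μ := spectrum_nonneg_of_nonneg h0 hsp
  have hre : μ = (μ.re : ℂ) := by
    obtain ⟨-, h2⟩ := Complex.le_def.1 hμ0
    exact Complex.ext rfl (by simpa using h2.symm)
  refine ⟨μ.re, lt_of_le_of_ne (Complex.le_def.1 hμ0).1 fun h => hne ?_, ?_⟩
  · rw [hμ, hre, ← h]; simp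
  · rw [hμ, hre, Algebra.algebraMap_eq_smul_one]
    simp

end Expectation

/-! ### The induced map on the sequence algebra -/

section Induced

variable {A : Type*} [CStarAlgebra A] {P : StarSubalgebra ℂ A}

/-- The map `E^∞` as an additive homomorphism. -/
noncomputable def expInf (E : A →L[ℂ] P) : SeqAlg A →+ SeqAlg A := SeqAlg.mapHom (toSelfMap E)

variable {E : A →L[ℂ] P}

theorem expInf_mk (f : ℕ →ᵇ A) :
    expInf E (SeqAlg.mk f) = SeqAlg.mk ((toSelfMap E).compLeftContinuousBounded ℕ f) := rfl

theorem expInf_smul (c : ℝ) (x : SeqAlg A) : expInf E (c • x) = c • expInf E x :=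
  SeqAlg.mapHom_smul _ _ _

/-- The fixed points of `E^∞` play the role of `P^∞`: the sequence `(E(fₖ))` represents the same
class. -/
theorem exists_mk_of_expInf_eq {x : SeqAlg A} (h : expInf E x = x) :
    ∃ f : ℕ →ᵇ A, SeqAlg.mk f = x ∧ ∀ k, f k ∈ P := by
  obtain ⟨f, rfl⟩ := SeqAlg.mk_surjective x
  exact ⟨_, h, fun k => (E (f k)).2⟩

theorem expInf_expInf (hE : IsConditionalExpectation E) (x : SeqAlg A) :
    expInf E (expInf E x) = expInf E x := by
  obtain ⟨f, rfl⟩ := SeqAlg.mk_surjective x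
  rw [expInf_mk, expInf_mk]
  congr 1
  ext k
  exact congrArg (Subtype.val : P → A) (hE.map_coe (E (f k)))

theorem expInf_mul_left (hE : IsConditionalExpectation E) (x y : SeqAlg A) :
    expInf E (expInf E x * y) = expInf E x * expInf E y := by
  obtain ⟨f, rfl⟩ := SeqAlg.mk_surjective x
  obtain ⟨g, rfl⟩ := SeqAlg.mk_surjective y
  rw [expInf_mk, expInf_mk, ← SeqAlg.mk_mul, ← SeqAlg.mk_mul, expInf_mk]
  congr 1
  ext k
  exact congrArg (Subtype.val : P → A) (hE.map_mul_left (E (f k)) (g k))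

theorem expInf_mul_right (hE : IsConditionalExpectation E) (x y : SeqAlg A) :
    expInf E (x * expInf E y) = expInf E x * expInf E y := by
  obtain ⟨f, rfl⟩ := SeqAlg.mk_surjective x
  obtain ⟨g, rfl⟩ := SeqAlg.mk_surjective y
  rw [expInf_mk, expInf_mk, ← SeqAlg.mk_mul, ← SeqAlg.mk_mul, expInf_mk]
  congr 1
  ext k
  exact congrArg (Subtype.val : P → A) (hE.map_mul_right (f k) (E (g k)))

theorem expInf_star (hE : IsConditionalExpectation E) (x : SeqAlg A) :
    expInf E (star x) = star (expInf E x) := by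
  obtain ⟨f, rfl⟩ := SeqAlg.mk_surjective x
  rw [SeqAlg.star_mk, expInf_mk, expInf_mk, SeqAlg.star_mk]
  congr 1
  ext k
  exact congrArg (Subtype.val : P → A) (hE.map_star (f k))

theorem expInf_const (hE : IsConditionalExpectation E) (b : P) :
    expInf E (SeqAlg.const (b : A)) = SeqAlg.const (b : A) := by
  rw [SeqAlg.const, expInf_mk]
  congr 1
  ext k
  exact congrArg (Subtype.val : P → A) (hE.map_coe b)

theorem expInf_one (hE : IsConditionalExpectation E) : expInf E 1 = 1 := expInf_const hE 1

theorem expInf_const_mul (hE : IsConditionalExpectation E) (b : P) (x : SeqAlg A) :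
    expInf E (SeqAlg.const (b : A) * x) = SeqAlg.const (b : A) * expInf E x := by
  rw [← expInf_const hE b, expInf_mul_left hE]

theorem expInf_mul_const (hE : IsConditionalExpectation E) (x : SeqAlg A) (b : P) :
    expInf E (x * SeqAlg.const (b : A)) = expInf E x * SeqAlg.const (b : A) := by
  rw [← expInf_const hE b, expInf_mul_right hE]

theorem IsQuasiBasis.sum_const_mul_expInf {n : ℕ} {u v : Fin n → A} (h : IsQuasiBasis E u v)
    (x : SeqAlg A) :
    ∑ i, SeqAlg.const (u i) * expInf E (SeqAlg.const (v i) * x) = x := by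
  obtain ⟨f, rfl⟩ := SeqAlg.mk_surjective x
  simp only [SeqAlg.const, ← SeqAlg.mk_mul, expInf_mk, ← SeqAlg.mk_sum]
  congr 1
  ext k
  simpa [BoundedContinuousFunction.coe_sum, toSelfMap_apply] using (h (f k)).1

theorem IsQuasiBasis.sum_expInf_mul_const {n : ℕ} {u v : Fin n → A} (h : IsQuasiBasis E u v)
    (x : SeqAlg A) :
    ∑ i, expInf E (x * SeqAlg.const (u i)) * SeqAlg.const (v i) = x := by
  obtain ⟨f, rfl⟩ := SeqAlg.mk_surjective x
  simp only [SeqAlg.const, ← SeqAlg.mk_mul, expInf_mk, ← SeqAlg.mk_sum]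
  congr 1
  ext k
  simpa [BoundedContinuousFunction.coe_sum, toSelfMap_apply] using (h (f k)).2

end Induced

/-! ### Rokhlin projections -/

section Rokhlin

variable {A : Type*} [CStarAlgebra A] {P : StarSubalgebra ℂ A}

/-- The projections in `A' ∩ A^∞` of the tracial Rokhlin property, for an expectation `E` of scalar
index `l`. -/
structure IsRokhlinProjection (E : A →L[ℂ] P) (l : ℝ) (e : SeqAlg A) : Prop where
  isStarProjection : IsStarProjection e
  comm : ∀ a : A, SeqAlg.const a * e = e * SeqAlg.const a
  isStarProjection_support : IsStarProjection (l • expInf E e)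
  injective : Function.Injective fun a : A => SeqAlg.const a * e

/-- The homomorphism `a ↦ (Index E) E^∞(a e)` from `A` to `P^∞`. -/
noncomputable def rokhlinMap (E : A →L[ℂ] P) (l : ℝ) (e : SeqAlg A) : A →+ SeqAlg A where
  toFun a := l • expInf E (SeqAlg.const a * e)
  map_zero' := by rw [SeqAlg.const_zero, zero_mul, map_zero, smul_zero]
  map_add' a b := by rw [SeqAlg.const_add, add_mul, map_add, smul_add]

variable {E : A →L[ℂ] P} {l : ℝ} {e : SeqAlg A}

theorem rokhlinMap_apply (a : A) : rokhlinMap E l e a = l • expInf E (SeqAlg.const a * e) := rfl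

theorem IsRokhlinProjection.const_mul_ne_zero (he : IsRokhlinProjection E l e) {a : A}
    (ha : a ≠ 0) : SeqAlg.const a * e ≠ 0 := fun h => ha <| he.injective <| by
  simpa [SeqAlg.const_zero] using h

/-- For `tᵢ = wᵢ - l E^∞(e wᵢ)` the quasi-basis identities give `∑ tᵢ tᵢ* = l - 2 l e + l g`.
Compressed by `e` this is `-l e (1 - g) e`, so the squares `(e tᵢ)(e tᵢ)*` and `l e (1 - g) e` add
up to zero and each `e tᵢ` vanishes. That is the claim for `x = wᵢ`; the expansion `x = ∑ wᵢ E^∞(wᵢ*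
x)` extends it to all `x`. -/
theorem IsRokhlinProjection.smul_mul_expInf (he : IsRokhlinProjection E l e)
    (hE : IsConditionalExpectation E) (hl : 0 < l) (hidx : index E = l • (1 : A))
    {n : ℕ} {w : Fin n → A} (hw : IsQuasiBasis E w fun i => star (w i)) (x : SeqAlg A) :
    l • (e * expInf E (e * x)) = e * x := by
  have hee : e * e = e := he.isStarProjection.isIdempotentElem
  have hes : star e = e := he.isStarProjection.isSelfAdjoint
  set g := l • expInf E e with hg
  have hgg : g * g = g := he.isStarProjection_support.isIdempotentElem
  have hgs : star g = g := he.isStarProjection_support.isSelfAdjoint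
  let W : Fin n → SeqAlg A := fun i => SeqAlg.const (w i)
  have hWW : ∑ i, W i * star (W i) = l • 1 := by
    rw [← SeqAlg.const_one, ← SeqAlg.const_smul, ← hidx, index_eq hw, SeqAlg.const_sum]
    rfl
  have hW1 : ∀ x, ∑ i, W i * expInf E (star (W i) * x) = x := hw.sum_const_mul_expInf
  have hW2 : ∀ x, ∑ i, expInf E (x * W i) * star (W i) = x := hw.sum_expInf_mul_const
  let t : Fin n → SeqAlg A := fun i => W i - l • expInf E (e * W i)
  have htt : ∀ i, t i * star (t i) = W i * star (W i) - l • (W i * expInf E (star (W i) * e))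
      - l • (expInf E (e * W i) * star (W i))
      + (l * l) • expInf E (e * (W i * expInf E (star (W i) * e))) := by
    intro i
    have h1 : star (expInf E (e * W i)) = expInf E (star (W i) * e) := by
      rw [← expInf_star hE, star_mul, hes]
    simp only [t, star_sub, star_smul, h1, star_trivial, sub_mul, mul_sub, smul_mul_assoc,
      mul_smul_comm, smul_sub, smul_smul, ← mul_assoc, expInf_mul_right hE]
    abel
  have hsum : ∑ i, t i * star (t i) = l • 1 - l • e - l • e + l • g := by
    simp only [htt, Finset.sum_add_distrib, Finset.sum_sub_distrib, ← Finset.smul_sum, hWW, hW1,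
      hW2, ← map_sum, ← Finset.mul_sum, hee, hg, smul_smul]
  let D : SeqAlg A := Real.sqrt l • ((1 - g) * e)
  have hD : star D * D = l • (e * (1 - g) * e) := by
    simp only [D, star_smul, star_mul, star_sub, star_one, hgs, hes, star_trivial, smul_mul_assoc,
      mul_smul_comm, smul_smul, Real.mul_self_sqrt hl.le]
    congr 1
    calc e * (1 - g) * ((1 - g) * e) = e * (1 - g - g + g * g) * e := by noncomm_ring
      _ = e * (1 - g) * e := by rw [hgg]; noncomm_ring
  let f : Option (Fin n) → SeqAlg A := fun o => o.elim D fun i => star (e * t i)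
  have hf : ∑ o, star (f o) * f o = 0 := by
    rw [Fintype.sum_option]
    simp only [f, Option.elim, hD, star_star]
    have : ∑ i, e * t i * star (e * t i) = e * (∑ i, t i * star (t i)) * e := by
      simp only [Finset.mul_sum, Finset.sum_mul, star_mul, hes, mul_assoc]
    rw [this, hsum]
    simp only [mul_add, mul_sub, add_mul, sub_mul, mul_smul_comm, smul_mul_assoc, mul_one, hee,
      smul_sub]
    abel
  have ht : ∀ i, e * W i = l • (e * expInf E (e * W i)) := by
    intro i
    have h1 : star (e * t i) = 0 :=
      SeqAlg.eq_zero_of_sum_star_mul_self_eq_zero hf (Finset.mem_univ (some i))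
    have h2 : e * t i = 0 := by rw [← star_star (e * t i), h1, star_zero]
    rwa [mul_sub, mul_smul_comm, sub_eq_zero] at h2
  calc l • (e * expInf E (e * x))
      = l • (e * expInf E (e * ∑ i, W i * expInf E (star (W i) * x))) := by rw [hW1]
    _ = ∑ i, (l • (e * expInf E (e * W i))) * expInf E (star (W i) * x) := by
        simp only [Finset.mul_sum, ← mul_assoc, map_sum, expInf_mul_right hE, Finset.smul_sum,
          smul_mul_assoc]
    _ = e * ∑ i, W i * expInf E (star (W i) * x) := by
        simp only [← ht, Finset.mul_sum, mul_assoc]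
    _ = e * x := by rw [hW1]

theorem expInf_rokhlinMap (hE : IsConditionalExpectation E) (a : A) :
    expInf E (rokhlinMap E l e a) = rokhlinMap E l e a := by
  rw [rokhlinMap_apply, expInf_smul, expInf_expInf hE]

theorem rokhlinMap_coe (hE : IsConditionalExpectation E) (b : P) :
    rokhlinMap E l e b = SeqAlg.const (b : A) * (l • expInf E e) := by
  rw [rokhlinMap_apply, expInf_const_mul hE, mul_smul_comm]

theorem IsRokhlinProjection.rokhlinMap_star (he : IsRokhlinProjection E l e)
    (hE : IsConditionalExpectation E) (a : A) :
    rokhlinMap E l e (star a) = star (rokhlinMap E l e a) := by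
  rw [rokhlinMap_apply, rokhlinMap_apply, star_smul, star_trivial l, ← expInf_star hE, star_mul,
    he.isStarProjection.isSelfAdjoint.star_eq, he.comm, SeqAlg.star_const]

theorem IsRokhlinProjection.comm_support (he : IsRokhlinProjection E l e)
    (hE : IsConditionalExpectation E) (b : P) :
    SeqAlg.const (b : A) * (l • expInf E e) = (l • expInf E e) * SeqAlg.const (b : A) := by
  rw [mul_smul_comm, smul_mul_assoc, ← expInf_const_mul hE, he.comm, expInf_mul_const hE]

theorem expInf_support (hE : IsConditionalExpectation E) :
    expInf E (l • expInf E e) = l • expInf E e := by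
  rw [expInf_smul, expInf_expInf hE]

/-- `l E^∞(a e) · l E^∞(e b) = l E^∞(a · l e E^∞(e b)) = l E^∞(a e b)`, by the module property and
then the key identity. -/
theorem IsRokhlinProjection.rokhlinMap_mul (he : IsRokhlinProjection E l e)
    (hE : IsConditionalExpectation E)
    (hcut : ∀ x, l • (e * expInf E (e * x)) = e * x) (a b : A) :
    rokhlinMap E l e (a * b) = rokhlinMap E l e a * rokhlinMap E l e b := by
  simp only [rokhlinMap_apply, smul_mul_assoc, mul_smul_comm]
  rw [he.comm b, ← expInf_mul_right hE, mul_assoc (SeqAlg.const a), ← expInf_smul l (_ * (e * _)),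
    ← mul_smul_comm l (SeqAlg.const a), hcut, SeqAlg.const_mul, mul_assoc, he.comm b]

/-- The support `g` of a Rokhlin projection is not annihilated by nonzero elements of `P`. -/
theorem IsRokhlinProjection.const_mul_support_ne_zero (he : IsRokhlinProjection E l e)
    (hE : IsConditionalExpectation E)
    (hcut : ∀ x, l • (e * expInf E (e * x)) = e * x) {b : P} (hb : b ≠ 0) :
    SeqAlg.const (b : A) * (l • expInf E e) ≠ 0 := by
  intro h
  have hb' : (b : A) ≠ 0 := fun h0 => hb (Subtype.ext h0)
  apply he.const_mul_ne_zero hb'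
  have h1 := hcut (SeqAlg.const (b : A))
  rw [← he.comm, expInf_const_mul hE, ← mul_smul_comm, ← mul_smul_comm, h, mul_zero] at h1
  exact h1.symm

/-- Isometries supported under a Rokhlin projection can be pushed into `P^∞`. -/
theorem IsRokhlinProjection.star_mul_self_sqrt_smul_expInf (he : IsRokhlinProjection E l e)
    (hE : IsConditionalExpectation E) (hl : 0 < l)
    (hcut : ∀ x, l • (e * expInf E (e * x)) = e * x) {v : SeqAlg A} (hv : e * v = v) :
    star (Real.sqrt l • expInf E v) * (Real.sqrt l • expInf E v) = expInf E (star v * v) := by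
  rw [star_smul, star_trivial, smul_mul_assoc, mul_smul_comm, smul_smul, Real.mul_self_sqrt hl.le,
    ← expInf_star hE, ← expInf_mul_right hE, ← expInf_smul, ← mul_smul_comm]
  have hes : star e = e := he.isStarProjection.isSelfAdjoint
  have h1 : star v = star v * e := by
    nth_rewrite 1 [← hv]; rw [star_mul, hes]
  rw [h1, mul_assoc, mul_smul_comm]
  have h2 := hcut v
  rw [hv] at h2
  rw [h2, mul_assoc, hv]

/-- In the presence of the tracial Rokhlin property, the complement of the support of a Rokhlin
projection can be made small with respect to a given nonzero element of `P`, within `P^∞`. -/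
theorem HasTracialRokhlinProperty.exists_isRokhlinProjection [Nontrivial A]
    (hR : HasTracialRokhlinProperty E) (hE : IsConditionalExpectation E) (hl : 0 < l)
    (hidx : index E = l • (1 : A))
    (hcut : ∀ e, IsRokhlinProjection E l e → ∀ x, l • (e * expInf E (e * x)) = e * x)
    {z : P} (hz : z ≠ 0) :
    ∃ e, IsRokhlinProjection E l e ∧ ∀ ε > 0, ∃ x : SeqAlg A, expInf E x = x ∧
      ‖star (SeqAlg.const (z : A) * x) * (SeqAlg.const (z : A) * x)
        - (1 - l • expInf E e)‖ < ε := by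
  have hsupp : ∀ e, SeqAlg.const (index E) * SeqAlg.map (toSelfMap E) e = l • expInf E e :=
    fun e => by
      rw [hidx, SeqAlg.const_smul, SeqAlg.const_one, smul_mul_assoc, one_mul]; rfl
  obtain ⟨e₀, h1, h2, h3, -, h5⟩ := hR 1 (by
    rw [← SeqAlg.const_one, Ne, SeqAlg.const_eq_zero]; exact one_ne_zero) ⟨1, by simp⟩
  have he₀ : IsRokhlinProjection E l e₀ := ⟨h1, h2, hsupp e₀ ▸ h3, h5⟩
  clear h1 h2 h3 h5
  have hee : e₀ * e₀ = e₀ := he₀.isStarProjection.isIdempotentElem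
  have hes : star e₀ = e₀ := he₀.isStarProjection.isSelfAdjoint
  set Z : SeqAlg A := SeqAlg.const (z : A) with hZ
  have hZe : Z * e₀ = e₀ * Z := he₀.comm z
  have hZs : star Z * e₀ = e₀ * star Z := by rw [hZ, SeqAlg.star_const, he₀.comm]
  -- The factor `e₀` places `v` approximately under `e₀`, where `√l E^∞` behaves isometrically. The
  -- factor `Z` on the left makes `v` approximately divisible by `Z`, which passes through `E^∞`.
  obtain ⟨e, h1, h2, h3, ⟨r, hr, hrc, v, hv1, hv2⟩, h5⟩ := hR (Z * star Z * e₀) (by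
      have : (z : A) * star (z : A) ≠ 0 := fun h => hz <| Subtype.ext <| by
        simpa using (CStarRing.mul_star_self_eq_zero_iff _).1 h
      rw [hZ, SeqAlg.star_const, ← SeqAlg.const_mul]
      exact he₀.const_mul_ne_zero this)
    ⟨star Z * e₀, by
      rw [star_mul, star_star, hes]
      calc Z * star Z * e₀ = Z * (star Z * e₀) * e₀ := by simp only [mul_assoc, hee]
        _ = Z * e₀ * (star Z * e₀) := by nth_rewrite 1 [hZs]; simp only [mul_assoc]
        _ = e₀ * Z * (star Z * e₀) := by rw [hZe]⟩
  have he : IsRokhlinProjection E l e := ⟨h1, h2, hsupp e ▸ h3, h5⟩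
  rw [hsupp] at hv1
  clear h1 h2 h3 h5
  refine ⟨e, he, fun ε hε => ?_⟩
  set g := l • expInf E e with hg
  have hvp : IsStarProjection (star v * v) := by
    rw [hv1]; exact he.isStarProjection_support.one_sub
  have hrv : r * v = v := by
    rw [← hv2]; exact SeqAlg.mul_star_mul_self_of_isStarProjection hvp
  have hvn : ‖v‖ ≤ 1 := by
    have := (SeqAlg.norm_sq_le v).trans (SeqAlg.norm_le_one_of_isStarProjection hvp)
    nlinarith [norm_nonneg v]
  set K := ‖toSelfMap E‖ with hK
  have hK0 : 0 ≤ K := norm_nonneg _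
  -- Replacing `v` by `v'` changes `v* v` by at most `3δ`, as `‖v‖ ≤ 1` and `‖v'‖ ≤ 2`; then `E^∞`
  -- multiplies the error by at most `K`.
  set δ := min 1 (ε / (3 * (K + 1))) with hδ
  have hδ0 : 0 < δ := by positivity
  have hδ1 : δ ≤ 1 := min_le_left _ _
  obtain ⟨_, ⟨x, rfl⟩, hx⟩ := Metric.mem_closure_iff.1 hrc δ hδ0
  rw [dist_comm, dist_eq_norm] at hx
  set m := Z * star Z * e₀ * x * (Z * star Z * e₀) with hm
  set v' := m * v with hv'
  have hdv : ‖v' - v‖ ≤ δ := by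
    have : v' - v = (m - r) * v := by rw [sub_mul, hrv]
    rw [this]
    refine (SeqAlg.norm_mul_le _ _).trans ?_
    calc ‖m - r‖ * ‖v‖ ≤ δ * 1 := by gcongr
      _ = δ := mul_one _
  have hv'n : ‖v'‖ ≤ 2 := by
    calc ‖v'‖ = ‖(v' - v) + v‖ := by rw [sub_add_cancel]
      _ ≤ ‖v' - v‖ + ‖v‖ := norm_add_le _ _
      _ ≤ 2 := by linarith
  have hdiff : ‖star v' * v' - star v * v‖ ≤ 3 * δ := by
    have e1 : star v' * v' - star v * v = star (v' - v) * v' + star v * (v' - v) := by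
      rw [star_sub]; noncomm_ring
    rw [e1]
    calc ‖star (v' - v) * v' + star v * (v' - v)‖
        ≤ ‖star (v' - v)‖ * ‖v'‖ + ‖star v‖ * ‖v' - v‖ :=
          (norm_add_le _ _).trans (add_le_add (SeqAlg.norm_mul_le _ _) (SeqAlg.norm_mul_le _ _))
      _ ≤ δ * 2 + 1 * δ := by
          gcongr
          · exact (SeqAlg.norm_star_le _).trans hdv
          · exact (SeqAlg.norm_star_le _).trans hvn
      _ = 3 * δ := by ring
  have hev' : e₀ * v' = v' := by
    rw [hv', hm]
    simp only [← mul_assoc]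
    rw [← hZe, mul_assoc Z, ← hZs, ← mul_assoc, mul_assoc (Z * star Z) e₀ e₀, hee]
  -- This is `√l E^∞(v')` with the leading factor `Z` of `v'` removed.
  refine ⟨Real.sqrt l • expInf E (star Z * e₀ * x * (Z * star Z * e₀) * v), ?_, ?_⟩
  · rw [expInf_smul, expInf_expInf hE]
  · have e1 : Z * (Real.sqrt l • expInf E (star Z * e₀ * x * (Z * star Z * e₀) * v))
        = Real.sqrt l • expInf E v' := by
      rw [mul_smul_comm, hZ, ← expInf_const_mul hE]
      simp only [hv', hm, hZ, mul_assoc]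
    rw [e1, he₀.star_mul_self_sqrt_smul_expInf hE hl (hcut e₀ he₀) hev']
    have e2 : (1 : SeqAlg A) - g = expInf E (star v * v) := by
      rw [hv1, map_sub, expInf_one hE, hg, expInf_support hE]
    rw [e2, ← map_sub]
    calc ‖expInf E (star v' * v' - star v * v)‖ ≤ K * ‖star v' * v' - star v * v‖ :=
          SeqAlg.norm_mapHom_le _ _
      _ ≤ K * (3 * δ) := by gcongr
      _ ≤ K * (3 * (ε / (3 * (K + 1)))) := by
          gcongr
          exact min_le_right _ _
      _ = ε * (K / (K + 1)) := by field_simp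
      _ < ε * 1 := by
          gcongr
          rw [div_lt_one (by positivity)]
          linarith
      _ = ε := mul_one _

end Rokhlin

/-! ### Subsequences in the sequence algebra -/

namespace SeqAlg

variable {A : Type*} [CStarAlgebra A]

/-- Passage to a subsequence. -/
noncomputable def reindex {σ : ℕ → ℕ} (hσ : Tendsto σ atTop atTop) : SeqAlg A →+* SeqAlg A :=
  Ideal.Quotient.lift (nullSeq A)
    { toFun := fun f => mk (f.compContinuous ⟨σ, continuous_of_discreteTopology⟩)
      map_one' := rfl
      map_mul' := fun _ _ => rfl
      map_zero' := rfl
      map_add' := fun _ _ => rfl }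
    fun _ hf => mk_eq_zero.2 (((mem_nullSeq A).1 hf).comp hσ)

variable {σ : ℕ → ℕ} (hσ : Tendsto σ atTop atTop)

theorem reindex_mk (f : ℕ →ᵇ A) :
    reindex hσ (mk f) = mk (f.compContinuous ⟨σ, continuous_of_discreteTopology⟩) := rfl

theorem reindex_const (a : A) : reindex hσ (const a) = const a := rfl

theorem reindex_star (x : SeqAlg A) : reindex hσ (star x) = star (reindex hσ x) := by
  obtain ⟨f, rfl⟩ := mk_surjective x
  rfl

theorem reindex_smul (c : ℝ) (x : SeqAlg A) : reindex hσ (c • x) = c • reindex hσ x := by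
  obtain ⟨f, rfl⟩ := mk_surjective x
  rfl

theorem reindex_expInf {P : StarSubalgebra ℂ A} (E : A →L[ℂ] P) (x : SeqAlg A) :
    reindex hσ (expInf E x) = expInf E (reindex hσ x) := by
  obtain ⟨f, rfl⟩ := mk_surjective x
  rfl

theorem isStarProjection_reindex {p : SeqAlg A} (hp : IsStarProjection p) :
    IsStarProjection (reindex hσ p) :=
  ⟨hp.isIdempotentElem.map (reindex hσ), by
    rw [IsSelfAdjoint, ← reindex_star, hp.isSelfAdjoint.star_eq]⟩

/-- A sequence without null subsequences is eventually bounded below. -/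
theorem eventually_le_norm {f : ℕ →ᵇ A}
    (h : ∀ (σ : ℕ → ℕ) (hσ : Tendsto σ atTop atTop), reindex hσ (mk f) ≠ 0) :
    ∃ c > 0, ∀ᶠ k in atTop, c ≤ ‖f k‖ := by
  by_contra! H
  obtain ⟨σ, hσ, hf⟩ := extraction_forall_of_frequently
    (P := fun n k => ‖f k‖ < 1 / ((n : ℝ) + 1)) fun n => H _ (by positivity)
  refine h σ hσ.tendsto_atTop ?_
  rw [reindex_mk, mk_eq_zero]
  exact squeeze_zero_norm (fun n => (hf n).le) tendsto_one_div_add_atTop_nhds_zero_nat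

theorem frequently_lt_norm {f : ℕ →ᵇ A} {c : ℝ} (hc : 0 ≤ c) (h : c < ‖mk f‖) :
    ∃ᶠ k in atTop, c < ‖f k‖ := by
  by_contra H
  rw [not_frequently] at H
  exact absurd (norm_mk_le hc (H.mono fun k hk => not_lt.1 hk)) (not_le.2 h)

end SeqAlg

/-! ### The structure of `P` -/

/-- Inclusions `P ⊆ A` with `A` simple and an expectation of scalar index `l`, for which the
complements of supports of Rokhlin projections can be made small within `P^∞`. -/
structure IsRokhlinInclusion {A : Type*} [CStarAlgebra A] {P : StarSubalgebra ℂ A}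
    (E : A →L[ℂ] P) (l : ℝ) : Prop where
  nontrivial : Nontrivial A
  simple : IsAlgebraicallySimple A
  isClosed : IsClosed (P : Set A)
  expectation : IsConditionalExpectation E
  cut : ∀ e, IsRokhlinProjection E l e → ∀ x, l • (e * expInf E (e * x)) = e * x
  exists_isRokhlinProjection : ∀ z : P, z ≠ 0 → ∃ e, IsRokhlinProjection E l e ∧
    ∀ ε > 0, ∃ x : SeqAlg A, expInf E x = x ∧
      ‖star (SeqAlg.const (z : A) * x) * (SeqAlg.const (z : A) * x)
        - (1 - l • expInf E e)‖ < ε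

section Inclusion

/-- For idempotent `g` the middle factor is the reflection `2g - 1`, which `g` compresses to `g`. A
difference of squares is the form that stays self-adjoint once `g` is replaced by arbitrary terms of
a representing sequence. -/
theorem compress_reflection {R : Type*} [Ring R] {g b c : R} (hg : g * g = g) (hb : b * g = g * b)
    (hc : c * g = g * c) :
    b * g * (g * c) = g * (b * (g * g - (1 - g) * (1 - g)) * c) * g := by
  have h1 : g * (g * g - (1 - g) * (1 - g)) * g = g := by
    have : g * g - (1 - g) * (1 - g) = g + g - 1 := by noncomm_ring
    rw [this, mul_sub, mul_add, hg, mul_one, add_sub_cancel_right, hg]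
  calc b * g * (g * c) = b * (g * g) * c := by simp only [mul_assoc]
    _ = b * (g * (g * g - (1 - g) * (1 - g)) * g) * c := by rw [h1, hg]
    _ = (b * g) * (g * g - (1 - g) * (1 - g)) * (g * c) := by simp only [mul_assoc]
    _ = g * (b * (g * g - (1 - g) * (1 - g)) * c) * g := by
      rw [hb, ← hc]; simp only [mul_assoc]

variable {A : Type*} [CStarAlgebra A] {P : StarSubalgebra ℂ A} {E : A →L[ℂ] P} {l : ℝ}

/-- Applying `φ` to an expression `∑ xᵢ b yᵢ = 1` in `A` puts `g` in the ideal of `b` in `P^∞`, and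
`1 - g` is approximated by `(b X)* (b X)`. A late term of the representing sequences then shows that
`1` is near the ideal of `b` in `P`. -/
theorem IsRokhlinInclusion.isAlgebraicallySimple (h : IsRokhlinInclusion E l) :
    IsAlgebraicallySimple P := by
  have hE := h.expectation
  have := h.isClosed
  intro b hb
  obtain ⟨m, x, y, hxy⟩ := h.simple (b : A) fun h0 => hb (Subtype.ext h0)
  obtain ⟨e, he, H⟩ := h.exists_isRokhlinProjection b hb
  obtain ⟨X, hX, hXn⟩ := H 1 one_pos
  have hmul := he.rokhlinMap_mul hE (h.cut e he)
  set φ := rokhlinMap E l e with hφ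
  have hg : φ 1 = l • expInf E e := by
    rw [hφ, rokhlinMap_apply, SeqAlg.const_one, one_mul]
  have hsum : ∑ i, φ (x i) * SeqAlg.const (b : A) * φ (y i) = φ 1 := by
    rw [← hxy, map_sum]
    refine Finset.sum_congr rfl fun i _ => ?_
    rw [hmul, hmul, hφ, rokhlinMap_coe hE, ← hφ, ← hg, ← mul_assoc, mul_assoc _ (φ 1), ← hmul,
      one_mul]
  choose f hf hfP using
    fun i => exists_mk_of_expInf_eq (expInf_rokhlinMap (l := l) (e := e) hE (x i))
  choose f' hf' hfP' using
    fun i => exists_mk_of_expInf_eq (expInf_rokhlinMap (l := l) (e := e) hE (y i))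
  obtain ⟨ξ, hξ, hξP⟩ := exists_mk_of_expInf_eq hX
  let β : ℕ →ᵇ A := BoundedContinuousFunction.const ℕ (b : A)
  let F : ℕ →ᵇ A := star (β * ξ) * (β * ξ) - (1 - ∑ i, f i * β * f' i)
  have hF : ‖SeqAlg.mk F‖ < 1 := by
    rw [← hg, ← hsum] at hXn
    convert hXn using 2
    simp only [F, SeqAlg.mk_sub, SeqAlg.mk_mul, SeqAlg.mk_sum, ← SeqAlg.star_mk, hf, hf', hξ,
      SeqAlg.mk_one]
    rfl
  obtain ⟨k, hk⟩ := (SeqAlg.eventually_norm_lt hF).exists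
  refine exists_sum_eq_one_of_norm_lt (m := m + 1)
    (x := Fin.cons (star (b * ⟨ξ k, hξP k⟩)) fun i => ⟨f i k, hfP i k⟩)
    (y := Fin.cons ⟨ξ k, hξP k⟩ fun i => ⟨f' i k, hfP' i k⟩) ?_
  rw [Fin.sum_univ_succ]
  simp only [Fin.cons_zero, Fin.cons_succ]
  refine lt_of_eq_of_lt ?_ hk
  change ‖(_ : A)‖ = ‖F k‖
  congr 1
  simp [F, β, BoundedContinuousFunction.coe_sum, mul_assoc]
  abel

/-- Injectivity is the only property that a subsequence could lose; but a projection commuting with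
the simple algebra `A` and annihilated by a nonzero element of it is zero. -/
theorem IsRokhlinInclusion.isRokhlinProjection_reindex (h : IsRokhlinInclusion E l)
    {e : SeqAlg A} (he : IsRokhlinProjection E l e) {σ : ℕ → ℕ} (hσ : Tendsto σ atTop atTop)
    (h0 : SeqAlg.reindex hσ e ≠ 0) : IsRokhlinProjection E l (SeqAlg.reindex hσ e) := by
  have hcomm : ∀ a : A, SeqAlg.const a * SeqAlg.reindex hσ e
      = SeqAlg.reindex hσ e * SeqAlg.const a := fun a => by
    rw [← SeqAlg.reindex_const hσ a, ← map_mul, he.comm, map_mul]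
  refine ⟨SeqAlg.isStarProjection_reindex hσ he.isStarProjection, hcomm, ?_, ?_⟩
  · rw [← SeqAlg.reindex_expInf, ← SeqAlg.reindex_smul]
    exact SeqAlg.isStarProjection_reindex hσ he.isStarProjection_support
  · intro a b hab
    by_contra hne
    obtain ⟨m, x, y, hxy⟩ := h.simple (a - b) (sub_ne_zero.2 hne)
    apply h0
    rw [← one_mul (SeqAlg.reindex hσ e), ← SeqAlg.const_one, ← hxy, SeqAlg.const_sum,
      Finset.sum_mul]
    refine Finset.sum_eq_zero fun i _ => ?_
    have : SeqAlg.const (a - b) * SeqAlg.reindex hσ e = 0 := by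
      rw [SeqAlg.const_sub, sub_mul]; exact sub_eq_zero.2 hab
    rw [SeqAlg.const_mul, mul_assoc, hcomm, SeqAlg.const_mul, mul_assoc,
      ← mul_assoc _ _ (SeqAlg.const (y i)), this, zero_mul, mul_zero]

/-- If no Rokhlin projection has full support, then the complements of the supports are not
annihilated by nonzero elements of `P`, even along subsequences. -/
theorem IsRokhlinInclusion.reindex_ne_zero (h : IsRokhlinInclusion E l)
    (hne : ∀ e, IsRokhlinProjection E l e → l • expInf E e ≠ 1)
    {e : SeqAlg A} (he : IsRokhlinProjection E l e) {b : P} (hb : b ≠ 0)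
    {σ : ℕ → ℕ} (hσ : Tendsto σ atTop atTop) :
    SeqAlg.reindex hσ ((1 - l • expInf E e) * SeqAlg.const (b : A)) ≠ 0 := by
  intro h0
  have hnt := h.nontrivial
  -- As `g` commutes with `P`, the elements of `P` annihilated by `1 - g` along `σ` form an ideal,
  -- which contains `b` and hence `1`.
  have h1 : SeqAlg.reindex hσ (1 - l • expInf E e) = 0 := by
    obtain ⟨m, x, y, hxy⟩ := h.isAlgebraicallySimple b hb
    have hxy' : ∑ i, (x i : A) * b * y i = 1 := by
      have := congrArg (Subtype.val : P → A) hxy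
      simpa using this
    have e1 : 1 - l • expInf E e = ∑ i, SeqAlg.const (x i : A) *
        ((1 - l • expInf E e) * SeqAlg.const (b : A)) * SeqAlg.const (y i : A) := by
      have e2 : 1 - l • expInf E e = (1 - l • expInf E e) * SeqAlg.const (1 : A) :=
        (mul_one _).symm
      nth_rewrite 1 [e2]
      rw [← hxy', SeqAlg.const_sum, Finset.mul_sum]
      refine Finset.sum_congr rfl fun i _ => ?_
      have := he.comm_support h.expectation (x i)
      rw [SeqAlg.const_mul, SeqAlg.const_mul, ← mul_assoc, ← mul_assoc, ← mul_assoc, mul_sub,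
        sub_mul, mul_one, one_mul, this]
    rw [e1, map_sum]
    refine Finset.sum_eq_zero fun i _ => ?_
    rw [map_mul, map_mul, h0, mul_zero, zero_mul]
  have h2 : l • expInf E (SeqAlg.reindex hσ e) = 1 := by
    rw [← SeqAlg.reindex_expInf, ← SeqAlg.reindex_smul]
    rw [map_sub, map_one, sub_eq_zero] at h1
    exact h1.symm
  refine hne _ (h.isRokhlinProjection_reindex he hσ fun h3 => ?_) h2
  rw [h3, map_zero, smul_zero, ← SeqAlg.const_one, ← SeqAlg.const_zero, eq_comm] at h2
  exact one_ne_zero (SeqAlg.const_eq_zero.1 h2)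

/-- Two orthogonal nonzero elements in the right ideal of a nonzero element of `P`. -/
theorem IsRokhlinInclusion.exists_orthogonal (h : IsRokhlinInclusion E l)
    (hne : ∀ e, IsRokhlinProjection E l e → l • expInf E e ≠ 1) {b : P} (hb : b ≠ 0) :
    ∃ x₁ x₂ : P, star (b * x₁) = b * x₁ ∧ star (b * x₂) = b * x₂ ∧ b * x₁ ≠ 0 ∧ b * x₂ ≠ 0 ∧
      (b * x₁) * (b * x₂) = 0 := by
  have hE := h.expectation
  have := h.isClosed
  obtain ⟨e, he, -⟩ := h.exists_isRokhlinProjection b hb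
  have hsb : star b ≠ 0 := star_ne_zero.2 hb
  have hgb := he.const_mul_support_ne_zero hE (h.cut e he) hsb
  have hhb := fun σ hσ => h.reindex_ne_zero hne he hsb (σ := σ) hσ
  have hgc := he.comm_support hE
  have hgg : (l • expInf E e) * (l • expInf E e) = l • expInf E e :=
    he.isStarProjection_support.isIdempotentElem
  have hgs : star (l • expInf E e) = l • expInf E e := he.isStarProjection_support.isSelfAdjoint
  obtain ⟨γ, hγ, hγP⟩ := exists_mk_of_expInf_eq (expInf_support (l := l) (e := e) hE)
  rw [hgc] at hgb
  rw [← hγ] at hgb hhb hgc hgg hgs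
  let β : ℕ →ᵇ A := BoundedContinuousFunction.const ℕ (b : A)
  have hβ : SeqAlg.mk β = SeqAlg.const (b : A) := rfl
  have hsβ : SeqAlg.mk (star β) = SeqAlg.const ((star b : P) : A) := rfl
  -- `d` represents `b (2g - 1) b*`. Its compression by `g` is that of a positive element, `b g b*`,
  -- and its compression by `1 - g` is `-b (1 - g) b*`; `s₁` and `s₂` are the null sequences
  -- expressing this. At a suitable index both `d⁺` and `d⁻` are therefore nonzero.
  let d : ℕ →ᵇ A := β * (star γ * γ - star (1 - γ) * (1 - γ)) * star β
  let s₁ : ℕ →ᵇ A := star (γ * star β) * (γ * star β) - star γ * d * γ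
  let s₂ : ℕ →ᵇ A := star ((1 - γ) * star β) * ((1 - γ) * star β) + star (1 - γ) * d * (1 - γ)
  have c1 := hgc b
  have c2 := hgc (star b)
  rw [← hβ] at c1
  rw [← hsβ, ← SeqAlg.star_mk] at c2
  have hs₁ : SeqAlg.mk s₁ = 0 := by
    simp only [s₁, d, SeqAlg.mk_sub, SeqAlg.mk_mul, ← SeqAlg.star_mk, SeqAlg.mk_one, star_mul,
      star_star, star_sub, star_one, hgs]
    exact sub_eq_zero.2 (compress_reflection hgg c1 c2)
  have hs₂ : SeqAlg.mk s₂ = 0 := by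
    simp only [s₂, d, SeqAlg.mk_add, SeqAlg.mk_sub, SeqAlg.mk_mul, ← SeqAlg.star_mk,
      SeqAlg.mk_one, star_mul, star_star, star_sub, star_one, hgs]
    have := compress_reflection (g := 1 - SeqAlg.mk γ) (b := SeqAlg.mk β)
      (c := star (SeqAlg.mk β)) (by rw [mul_sub, sub_mul, sub_mul, hgg]; noncomm_ring)
      (by rw [mul_sub, sub_mul, c1, mul_one, one_mul])
      (by rw [mul_sub, sub_mul, c2, mul_one, one_mul])
    rw [this, sub_sub_cancel]
    noncomm_ring
  obtain ⟨c₂, hc₂, hev₂⟩ := SeqAlg.eventually_le_norm (f := (1 - γ) * star β) hhb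
  have hpos : 0 < ‖SeqAlg.mk (γ * star β)‖ :=
    lt_of_le_of_ne (norm_nonneg _) fun h0 => hgb (SeqAlg.norm_eq_zero_iff.1 h0.symm)
  set c₁ := ‖SeqAlg.mk (γ * star β)‖ / 2 with hc₁
  have hc₁0 : 0 < c₁ := by positivity
  have hfr := SeqAlg.frequently_lt_norm hc₁0.le (half_lt_self hpos)
  have hev : ∀ᶠ k in atTop, c₂ ≤ ‖((1 - γ) * star β) k‖ ∧ ‖s₁ k‖ < c₁ ^ 2 ∧ ‖s₂ k‖ < c₂ ^ 2 :=
    hev₂.and ((SeqAlg.eventually_norm_lt (by rw [hs₁, norm_zero]; positivity)).and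
      (SeqAlg.eventually_norm_lt (by rw [hs₂, norm_zero]; positivity)))
  -- The lower bound for `g b*` holds only frequently, so the one for `(1 - g) b*` has to hold
  -- eventually; this is why nonvanishing along all subsequences was needed.
  obtain ⟨k, hk1, hk2, hk3, hk4⟩ := (hfr.and_eventually hev).exists
  let γk : P := ⟨γ k, hγP k⟩
  let u : P := star γk * γk - star (1 - γk) * (1 - γk)
  let dk : P := b * u * star b
  have hdk : star dk = dk := by
    simp only [dk, u, star_mul, star_sub, star_star, star_one, mul_assoc]
  obtain ⟨x₁, x₂, hx1, hx2, hx12, H1, H2⟩ := exists_orthogonal_of_isSelfAdjoint hdk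
  have e1 : ∀ x, dk * x = b * (u * star b * x) := fun x => by simp only [dk, mul_assoc]
  rw [e1, e1] at hx12
  rw [e1] at hx1 hx2 H1 H2
  refine ⟨_, _, hx1, hx2, fun h0 => ?_, fun h0 => ?_, hx12⟩
  · obtain ⟨c, hc⟩ := H1 h0
    -- Were `d k` negative, `s₁ k` would be a sum of two squares, the first of norm above `c₁²`.
    have hd : d k = -(star (c : A) * c) := congrArg (Subtype.val : P → A) hc
    have e2 : s₁ k = star (γ k * star (b : A)) * (γ k * star (b : A))
        + star ((c : A) * γ k) * ((c : A) * γ k) := by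
      change star (γ k * star (b : A)) * (γ k * star (b : A)) - star (γ k) * d k * γ k = _
      rw [hd, star_mul (c : A)]; noncomm_ring
    have e3 := norm_sq_le_norm_sum_star_mul_self Finset.univ
      ![γ k * star (b : A), (c : A) * γ k] (Finset.mem_univ 0)
    rw [Fin.sum_univ_two] at e3
    simp only [Matrix.cons_val_zero, Matrix.cons_val_one, ← e2] at e3
    have hk1' : c₁ < ‖γ k * star (b : A)‖ := hk1
    nlinarith
  · obtain ⟨c, hc⟩ := H2 h0
    have hd : d k = star (c : A) * c := congrArg (Subtype.val : P → A) hc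
    have e2 : s₂ k = star ((1 - γ k) * star (b : A)) * ((1 - γ k) * star (b : A))
        + star ((c : A) * (1 - γ k)) * ((c : A) * (1 - γ k)) := by
      change star ((1 - γ k) * star (b : A)) * ((1 - γ k) * star (b : A))
        + star (1 - γ k) * d k * (1 - γ k) = _
      rw [hd, star_mul (c : A)]; simp only [mul_assoc]
    have e3 := norm_sq_le_norm_sum_star_mul_self Finset.univ
      ![(1 - γ k) * star (b : A), (c : A) * (1 - γ k)] (Finset.mem_univ 0)
    rw [Fin.sum_univ_two] at e3
    simp only [Matrix.cons_val_zero, Matrix.cons_val_one, ← e2] at e3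
    have hk2' : c₂ ≤ ‖(1 - γ k) * star (b : A)‖ := hk2
    nlinarith

end Inclusion

/-! ### Orthogonal copies of a projection in a right ideal of `P` -/

section Copies

variable {A : Type*} [CStarAlgebra A] {P : StarSubalgebra ℂ A} {E : A →L[ℂ] P} {l : ℝ}

/-- Two orthogonal equivalent elements in the right ideal of a nonzero element of `P`. -/
theorem IsRokhlinInclusion.exists_two_copies (h : IsRokhlinInclusion E l)
    (hne : ∀ e, IsRokhlinProjection E l e → l • expInf E e ≠ 1) {b : P} (hb : b ≠ 0) :
    ∃ (x : Bool → P) (c : P), c ≠ 0 ∧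
      ∀ i j, star (b * x i) * (b * x j) = if i = j then star c * c else 0 := by
  have := h.isClosed
  obtain ⟨x₁, x₂, h1, h2, hn1, hn2, h12⟩ := h.exists_orthogonal hne hb
  set a₁ := b * x₁ with ha₁
  set a₂ := b * x₂ with ha₂
  obtain ⟨y, hy⟩ := h.isAlgebraicallySimple.exists_mul_mul_ne_zero hn1 hn2
  set c := a₁ * y * a₂ with hc
  obtain ⟨d, hds, hdd⟩ := exists_star_mul_self_sqrt c
  have hcn : star c * c ≠ 0 := fun h0 => hy ((CStarRing.star_mul_self_eq_zero_iff c).1 h0)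
  have hsc : star c = a₂ * star y * a₁ := by
    rw [hc, star_mul (a₁ * y) a₂, star_mul a₁ y, h1, h2, ← mul_assoc]
  -- With `d = |c|`, the elements `c d` in `a₁ P` and `c* c` in `a₂ P` both have square `(c* c)²`;
  -- they are orthogonal because `a₁ a₂ = 0`.
  have e1 : b * (x₁ * y * a₂ * d) = c * d := by rw [hc, ha₁]; simp only [mul_assoc]
  have e2 : b * (x₂ * star y * a₁ * c) = star c * c := by
    rw [hsc, ha₂]; simp only [mul_assoc]
  have e12 : star (c * d) * (star c * c) = 0 := by
    calc star (c * d) * (star c * c) = d * (a₂ * star y * (a₁ * a₂) * star y * a₁ * c) := by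
          rw [star_mul, hds, hsc]; simp only [mul_assoc]
      _ = 0 := by rw [h12]; simp
  refine ⟨fun i => bif i then x₁ * y * a₂ * d else x₂ * star y * a₁ * c, star c * c, hcn, ?_⟩
  rintro (_ | _) (_ | _)
  · simp only [cond_false, e2, if_true]
  · simp only [cond_false, cond_true, e1, e2]
    rw [if_neg (by decide), ← star_star (c * d), ← star_mul, e12, star_zero]
  · simp only [cond_false, cond_true, e1, e2]
    rw [if_neg (by decide), e12]
  · simp only [cond_true, e1, if_true]
    calc star (c * d) * (c * d) = d * (star c * c) * d := by
          rw [star_mul, hds]; simp only [mul_assoc]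
      _ = (d * d) * (d * d) := by rw [← hdd]; simp only [mul_assoc]
      _ = _ := by rw [hdd, (IsSelfAdjoint.star_mul_self c).star_eq]

/-- Arbitrarily many orthogonal equivalent elements in the right ideal of a nonzero element. -/
theorem IsRokhlinInclusion.exists_copies (h : IsRokhlinInclusion E l)
    (hne : ∀ e, IsRokhlinProjection E l e → l • expInf E e ≠ 1) {b : P} (hb : b ≠ 0) (N : ℕ) :
    ∃ (x : Fin N → P) (c : P), c ≠ 0 ∧
      ∀ i j, star (b * x i) * (b * x j) = if i = j then star c * c else 0 := by
  classical
  -- Each step doubles the family, which preserves the strict bound `N < card ι`.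
  suffices H : ∃ (ι : Type) (_ : Fintype ι) (x : ι → P) (c : P), N < Fintype.card ι ∧ c ≠ 0 ∧
      ∀ i j, star (b * x i) * (b * x j) = if i = j then star c * c else 0 by
    obtain ⟨ι, _, x, c, hN, hc, hx⟩ := H
    obtain ⟨f⟩ := Function.Embedding.nonempty_of_card_le (α := Fin N) (β := ι)
      (by simpa using hN.le)
    refine ⟨fun i => x (f i), c, hc, fun i j => ?_⟩
    rw [hx]
    simp only [f.injective.eq_iff]
  induction N with
  | zero => exact ⟨Unit, inferInstance, fun _ => 1, b, by simp, hb, by simp⟩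
  | succ N ih =>
    obtain ⟨ι, _, x, c, hN, hc, hx⟩ := ih
    obtain ⟨x', c', hc', hx'⟩ := h.exists_two_copies hne hc
    refine ⟨ι × Bool, inferInstance, fun i => x i.1 * x' i.2, c', ?_, hc', ?_⟩
    · rw [Fintype.card_prod, Fintype.card_bool]; omega
    · rintro ⟨i, s⟩ ⟨j, t⟩
      have e : star (b * (x i * x' s)) * (b * (x j * x' t))
          = star (x' s) * (star (b * x i) * (b * x j)) * x' t := by
        simp only [star_mul, mul_assoc]
      simp only [e, hx, Prod.mk.injEq]
      by_cases hij : i = j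
      · simp only [hij, if_true, true_and]
        rw [← hx', star_mul]
        simp only [mul_assoc]
      · simp [hij]

/-- Every nonzero element of `P` can be multiplied on the right to a nonzero partial isometry. -/
theorem IsRokhlinInclusion.exists_isStarProjection (h : IsRokhlinInclusion E l)
    (hne : ∀ e, IsRokhlinProjection E l e → l • expInf E e ≠ 1) {z : P} (hz : z ≠ 0) :
    ∃ x : P, IsStarProjection (star (z * x) * (z * x)) ∧ z * x ≠ 0 := by
  have := h.isClosed
  obtain ⟨e, he, H⟩ := h.exists_isRokhlinProjection z hz
  -- Distance `1/20` from a nonzero projection gives `‖F‖ > 1/2` and `‖F² - F‖ < 1/4`, as the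
  -- functional calculus requires.
  obtain ⟨X, hX, hXn⟩ := H (1 / 20) (by norm_num)
  set p := 1 - l • expInf E e with hp
  have hpp : IsStarProjection p := he.isStarProjection_support.one_sub
  have hp0 : p ≠ 0 := fun h0 => hne e he (sub_eq_zero.1 h0).symm
  obtain ⟨ξ, hξ, hξP⟩ := exists_mk_of_expInf_eq hX
  let F : ℕ →ᵇ A := star (BoundedContinuousFunction.const ℕ (z : A) * ξ)
    * (BoundedContinuousFunction.const ℕ (z : A) * ξ)
  have hF : SeqAlg.mk F = star (SeqAlg.const (z : A) * X) * (SeqAlg.const (z : A) * X) := by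
    rw [← hξ]; rfl
  rw [← hF] at hXn
  have hpn := SeqAlg.norm_le_one_of_isStarProjection hpp
  have hpn' := SeqAlg.one_le_norm_of_isStarProjection hpp hp0
  have hD1 : ‖SeqAlg.mk F‖ ≤ 21 / 20 := by
    calc ‖SeqAlg.mk F‖ = ‖(SeqAlg.mk F - p) + p‖ := by rw [sub_add_cancel]
      _ ≤ ‖SeqAlg.mk F - p‖ + ‖p‖ := norm_add_le _ _
      _ ≤ 21 / 20 := by linarith
  have hD2 : 1 / 2 < ‖SeqAlg.mk F‖ := by
    have : ‖p‖ ≤ ‖SeqAlg.mk F‖ + ‖SeqAlg.mk F - p‖ := by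
      calc ‖p‖ = ‖SeqAlg.mk F - (SeqAlg.mk F - p)‖ := by rw [sub_sub_cancel]
        _ ≤ _ := norm_sub_le _ _
    linarith
  have hD3 : ‖SeqAlg.mk (F * F - F)‖ < 1 / 4 := by
    have e1 : SeqAlg.mk (F * F - F) = SeqAlg.mk F * (SeqAlg.mk F - p) + (SeqAlg.mk F - p) * p
        - (SeqAlg.mk F - p) := by
      have hpp' : p * p = p := hpp.isIdempotentElem
      rw [SeqAlg.mk_sub, SeqAlg.mk_mul, mul_sub, sub_mul, hpp']; abel
    rw [e1]
    calc _ ≤ ‖SeqAlg.mk F‖ * ‖SeqAlg.mk F - p‖ + ‖SeqAlg.mk F - p‖ * ‖p‖ + ‖SeqAlg.mk F - p‖ :=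
          (norm_sub_le _ _).trans (add_le_add_left ((norm_add_le _ _).trans
            (add_le_add (SeqAlg.norm_mul_le _ _) (SeqAlg.norm_mul_le _ _))) _)
      _ ≤ (21 / 20) * (1 / 20) + (1 / 20) * 1 + 1 / 20 := by gcongr
      _ < 1 / 4 := by norm_num
  obtain ⟨k, hk1, hk2⟩ := ((SeqAlg.frequently_lt_norm (by norm_num) hD2).and_eventually
    (SeqAlg.eventually_norm_lt hD3)).exists
  obtain ⟨x, hx1, hx2⟩ := exists_isStarProjection_of_near (y := z * ⟨ξ k, hξP k⟩) hk2 hk1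
  rw [mul_assoc] at hx1 hx2
  exact ⟨_, hx1, hx2⟩

/-- Arbitrarily many orthogonal equivalent nonzero partial isometries in the right ideal of a
nonzero element of `P`. -/
theorem IsRokhlinInclusion.exists_projection_copies (h : IsRokhlinInclusion E l)
    (hne : ∀ e, IsRokhlinProjection E l e → l • expInf E e ≠ 1) {b : P} (hb : b ≠ 0) (N : ℕ) :
    ∃ (x : Fin N → P) (t : P), t ≠ 0 ∧ IsStarProjection t ∧ (∀ i, x i * t = x i) ∧
      ∀ i j, star (b * x i) * (b * x j) = if i = j then t else 0 := by
  have := h.isClosed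
  obtain ⟨x, c, hc, hx⟩ := h.exists_copies hne hb N
  obtain ⟨y, hy, hy0⟩ := h.exists_isStarProjection hne hc
  set t := star (c * y) * (c * y) with ht
  have htt : t * t = t := hy.isIdempotentElem
  have hts : star t = t := hy.isSelfAdjoint
  refine ⟨fun i => x i * y * t, t, fun h0 => hy0 ((CStarRing.star_mul_self_eq_zero_iff _).1 h0),
    hy, fun i => by rw [mul_assoc, htt], fun i j => ?_⟩
  have e : star (b * (x i * y * t)) * (b * (x j * y * t))
      = t * (star y * (star (b * x i) * (b * x j)) * y) * t := by
    simp only [star_mul, mul_assoc, hts]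
  rw [e, hx]
  split_ifs
  · have : star y * (star c * c) * y = t := by rw [ht, star_mul]; simp only [mul_assoc]
    rw [this, htt, htt]
  · simp

end Copies

/-! ### Comparison of projections over `P` -/

section Comparison

variable {A : Type*} [CStarAlgebra A] {P : StarSubalgebra ℂ A} {E : A →L[ℂ] P} {l : ℝ}

/-- The inclusion of `P` in `A^∞` by constant sequences. -/
noncomputable def constCoe (P : StarSubalgebra ℂ A) : P →+* SeqAlg A :=
  SeqAlg.constHom.comp (P.subtype : P →+* A)

/-- A matrix over `P^∞` implementing a subequivalence up to a small error can be replaced by a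
matrix over `P`. -/
theorem mvNSubequiv_of_norm_entry_lt (hP : IsClosed (P : Set A)) (n : ℕ) :
    ∃ δ > 0, ∀ (p q : Matrix (Fin n) (Fin n) P) (Z : Matrix (Fin n) (Fin n) (SeqAlg A)),
      IsStarProjection p → IsStarProjection q → (∀ i j, expInf E (Z i j) = Z i j) →
      (∀ i j, ‖(star Z * (constCoe P).mapMatrix q * Z - (constCoe P).mapMatrix p) i j‖ < δ) →
      MvNSubequiv p q := by
  have := hP
  obtain ⟨δ, hδ, H⟩ := exists_pos_mvNSubequiv_matrix P n
  refine ⟨δ, hδ, fun p q Z hp hq hZ hn => ?_⟩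
  choose f hf hfP using fun i j => exists_mk_of_expInf_eq (hZ i j)
  let F : Fin n → Fin n → ℕ →ᵇ A := fun i j =>
    ∑ k, (∑ m, star (f m i) * BoundedContinuousFunction.const ℕ (q m k : A)) * f k j
      - BoundedContinuousFunction.const ℕ (p i j : A)
  have hF : ∀ i j, SeqAlg.mk (F i j)
      = (star Z * (constCoe P).mapMatrix q * Z - (constCoe P).mapMatrix p) i j := by
    intro i j
    simp only [F, SeqAlg.mk_sub, SeqAlg.mk_sum, SeqAlg.mk_mul, ← SeqAlg.star_mk, hf,
      Matrix.sub_apply, Matrix.mul_apply, Matrix.star_apply]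
    rfl
  have hev : ∀ᶠ k in atTop, ∀ i j, ‖F i j k‖ < δ :=
    eventually_all.2 fun i => eventually_all.2 fun j =>
      SeqAlg.eventually_norm_lt (by rw [hF]; exact hn i j)
  obtain ⟨k, hk⟩ := hev.exists
  refine H p q (Matrix.of fun i j => ⟨f i j k, hfP i j k⟩) hp hq fun i j => ?_
  refine lt_of_eq_of_lt ?_ (hk i j)
  change ‖(_ : A)‖ = _
  congr 1
  simp [F, Matrix.mul_apply, Matrix.star_apply, BoundedContinuousFunction.coe_sum]

/-- The two summands of `Z = φ(y) + Y V p` have orthogonal ranges since `r Y = 0`. Their squares are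
`p g` and `p V* V p`, so `Z* q Z - p = p (V* V - (1 - g)) p`, which is small. -/
theorem IsRokhlinInclusion.mvNSubequiv (h : IsRokhlinInclusion E l) {e : SeqAlg A}
    (he : IsRokhlinProjection E l e) {n : ℕ} {p q r Y : Matrix (Fin n) (Fin n) P}
    (hp : IsStarProjection p) (hq : IsStarProjection q) {t : P} (ht : IsStarProjection t)
    (hr : star r = r) (hqr : q * r = r) (hqY : q * Y = Y) (hrY : r * Y = 0)
    (hYY : star Y * Y = Matrix.diagonal fun _ => t)
    {y : Matrix (Fin n) (Fin n) A} (hyy : star y * y = (P.subtype : P →+* A).mapMatrix p)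
    (hry : (P.subtype : P →+* A).mapMatrix r * y = y)
    (hX : ∀ ε > 0, ∃ x : SeqAlg A, expInf E x = x ∧
      ‖star (SeqAlg.const (t : A) * x) * (SeqAlg.const (t : A) * x)
        - (1 - l • expInf E e)‖ < ε) : MvNSubequiv p q := by
  have hE := h.expectation
  obtain ⟨δ, hδ, H⟩ := mvNSubequiv_of_norm_entry_lt (E := E) h.isClosed n
  have hmul := he.rokhlinMap_mul hE (h.cut e he)
  set φ := rokhlinMap E l e with hφ
  set g := l • expInf E e with hg
  have hpp : p * p = p := hp.isIdempotentElem
  have hps : star p = p := hp.isSelfAdjoint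
  let C : Matrix (Fin n) (Fin n) P →+* Matrix (Fin n) (Fin n) (SeqAlg A) := (constCoe P).mapMatrix
  let ι : Matrix (Fin n) (Fin n) P →+* Matrix (Fin n) (Fin n) A := (P.subtype : P →+* A).mapMatrix
  let Φ : Matrix (Fin n) (Fin n) A → Matrix (Fin n) (Fin n) (SeqAlg A) := fun M => M.map φ
  let D : SeqAlg A → Matrix (Fin n) (Fin n) (SeqAlg A) := fun x => Matrix.diagonal fun _ => x
  have hCs : ∀ M, star (C M) = C (star M) := fun M => by
    ext i j; rfl
  have hΦm : ∀ M N, Φ (M * N) = Φ M * Φ N := fun M N => by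
    ext i j
    simp only [Φ, Matrix.map_apply, Matrix.mul_apply, map_sum, hmul]
  have hΦs : ∀ M, star (Φ M) = Φ (star M) := fun M => by
    ext i j
    simp only [Φ, Matrix.map_apply, Matrix.star_apply, hφ, he.rokhlinMap_star hE]
  have hΦC : ∀ M, Φ (ι M) = C M * D g := fun M => by
    ext i j
    simp only [Φ, D, Matrix.map_apply, Matrix.mul_diagonal]
    exact rokhlinMap_coe hE (M i j)
  have hDm : ∀ x z, D (x * z) = D x * D z := fun x z => by
    simp only [D, Matrix.diagonal_mul_diagonal]
  have hDs : ∀ x, star (D x) = D (star x) := fun x => by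
    simp only [D, Matrix.star_eq_conjTranspose, Matrix.diagonal_conjTranspose]; rfl
  have hDC : ∀ M, D g * C M = C M * D g := fun M => by
    ext i j
    simp only [D, Matrix.diagonal_mul, Matrix.mul_diagonal]
    exact (he.comm_support hE (M i j)).symm
  have hDΦ : ∀ M, D g * Φ M = Φ M := fun M => by
    have : Φ 1 = D g := by
      have h1 := hΦC 1
      rwa [map_one, map_one, one_mul] at h1
    rw [← this, ← hΦm, one_mul]
  have hΦy : C r * Φ y = Φ y := by
    have h1 : Φ (ι r * y) = Φ y := by rw [hry]
    rwa [hΦm, hΦC, mul_assoc, hDΦ] at h1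
  have hΦp : star (Φ y) * Φ y = C p * D g := by rw [hΦs, ← hΦm, hyy, hΦC]
  set S : ℝ := ∑ i, ∑ j, ‖C p i j‖ with hS
  have hS0 : 0 ≤ S := by positivity
  -- `S` bounds the entries and the row sums of `p`, so the entries of `p Δ p` have norm at most `S²
  -- ‖Δ‖`.
  obtain ⟨X, hXE, hXn⟩ := hX (δ / (S * S + 1)) (by positivity)
  set V := SeqAlg.const (t : A) * X with hV
  have htV : SeqAlg.const (t : A) * V = V := by
    have h1 : (t : A) * t = t := congrArg (Subtype.val : P → A) ht.isIdempotentElem.eq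
    rw [hV, ← mul_assoc, ← SeqAlg.const_mul, h1]
  let Z := Φ y + C Y * D V * C p
  have hqZ : C q * Z = Z := by
    have h1 : C q * Φ y = Φ y := by rw [← hΦy, ← mul_assoc, ← map_mul, hqr]
    simp only [Z, mul_add, h1, ← mul_assoc, ← map_mul, hqY]
  have hcross : star (Φ y) * (C Y * D V * C p) = 0 := by
    rw [← hΦy, star_mul, hCs, hr, mul_assoc, ← mul_assoc (C r), ← mul_assoc (C r), ← map_mul, hrY,
      map_zero, zero_mul, zero_mul, mul_zero]
  have hcross' : star (C Y * D V * C p) * Φ y = 0 := by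
    rw [← star_star (Φ y), ← star_mul, hcross, star_zero]
  have hlast : star (C Y * D V * C p) * (C Y * D V * C p) = C p * D (star V * V) * C p := by
    have h1 : C (star Y * Y) = D (SeqAlg.const (t : A)) := by
      rw [hYY]
      ext i j
      change constCoe P ((Matrix.diagonal fun _ => t) i j) = _
      simp only [D, Matrix.diagonal_apply]
      split_ifs
      · rfl
      · exact map_zero _
    calc star (C Y * D V * C p) * (C Y * D V * C p)
        = C p * (D (star V) * (C (star Y * Y) * D V)) * C p := by
          simp only [star_mul, hCs, hDs, hps, map_mul, mul_assoc]
      _ = _ := by rw [h1, ← hDm, htV, ← hDm]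
  have hCpp : C p * C p = C p := by rw [← map_mul, hpp]
  have hfinal : star Z * C q * Z - C p = C p * D (star V * V - (1 - g)) * C p := by
    have hD1 : D (star V * V - (1 - g)) = D (star V * V) - (1 - D g) := by
      ext i j
      simp only [D, Matrix.diagonal_apply, Matrix.sub_apply, Matrix.one_apply]
      split_ifs <;> simp
    rw [mul_assoc, hqZ, hD1, mul_sub, sub_mul, mul_sub, sub_mul, mul_one, hCpp, mul_assoc _ (D g),
      hDC, ← mul_assoc (C p) (C p) (D g), hCpp]
    simp only [Z, star_add, add_mul, mul_add, hcross, hcross', hlast, hΦp]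
    abel
  refine H p q Z hp hq (fun i j => ?_) fun i j => ?_
  · have hV' : expInf E V = V := by rw [hV, expInf_const_mul hE, hXE]
    have hentry : (C Y * D V * C p) i j = ∑ k, C Y i k * V * C p k j := by
      rw [Matrix.mul_apply]
      simp only [D, Matrix.mul_diagonal]
    simp only [Z, Φ, Matrix.add_apply, Matrix.map_apply, hentry, map_add, map_sum]
    rw [hφ, expInf_rokhlinMap hE]
    congr 1
    refine Finset.sum_congr rfl fun k _ => ?_
    change expInf E (SeqAlg.const (Y i k : A) * V * SeqAlg.const (p k j : A)) = _
    rw [expInf_mul_const hE, expInf_const_mul hE, hV']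
    rfl
  · change ‖(star Z * C q * Z - C p) i j‖ < δ
    rw [hfinal, Matrix.mul_apply]
    simp only [D, Matrix.mul_diagonal]
    set Δ := star V * V - (1 - g)
    have hle : ∀ i k, ‖C p i k‖ ≤ S := fun i k =>
      (Finset.single_le_sum (f := fun k => ‖C p i k‖) (fun _ _ => norm_nonneg _)
        (Finset.mem_univ k)).trans
      (Finset.single_le_sum (f := fun i => ∑ k, ‖C p i k‖)
        (fun _ _ => Finset.sum_nonneg fun _ _ => norm_nonneg _) (Finset.mem_univ i))
    have hrow : ∑ k, ‖C p i k‖ ≤ S :=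
      Finset.single_le_sum (f := fun i => ∑ k, ‖C p i k‖)
        (fun _ _ => Finset.sum_nonneg fun _ _ => norm_nonneg _) (Finset.mem_univ i)
    calc ‖∑ k, C p i k * Δ * C p k j‖ ≤ ∑ k, ‖C p i k‖ * ‖Δ‖ * S := by
          refine norm_sum_le_of_le _ fun k _ => ?_
          refine (SeqAlg.norm_mul_le _ _).trans ?_
          gcongr
          · exact SeqAlg.norm_mul_le _ _
          · exact hle k j
      _ = (∑ k, ‖C p i k‖) * ‖Δ‖ * S := by rw [Finset.sum_mul, Finset.sum_mul]
      _ ≤ S * (δ / (S * S + 1)) * S := by gcongr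
      _ = δ * ((S * S) / (S * S + 1)) := by ring
      _ < δ * 1 := by
          gcongr
          rw [div_lt_one (by positivity)]
          linarith
      _ = δ := mul_one _

end Comparison

/-! ### Traces on matrices and the main theorem -/

section Main

theorem exists_sum_star_mul_self_eq {B : Type*} [CStarAlgebra B] {ι : Type*} (s : Finset ι)
    (x : ι → B) : ∃ b : B, ∑ i ∈ s, star (x i) * x i = star b * b := by
  let := CStarAlgebra.spectralOrder B
  have := CStarAlgebra.spectralOrderedRing B
  exact CStarAlgebra.nonneg_iff_eq_star_mul_self.1
    (Finset.sum_nonneg fun i _ => star_mul_self_nonneg (x i))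

theorem IsTracialState.sum_mul_comm {B : Type*} [Ring B] [StarRing B] [Algebra ℂ B]
    {τ : B →ₗ[ℂ] ℂ} (hτ : IsTracialState τ) {n : ℕ} (x y : Matrix (Fin n) (Fin n) B) :
    ∑ i, τ ((x * y) i i) = ∑ i, τ ((y * x) i i) := by
  simp only [Matrix.mul_apply, map_sum]
  rw [Finset.sum_comm]
  exact Finset.sum_congr rfl fun i _ => Finset.sum_congr rfl fun j _ => hτ.trace _ _

theorem IsTracialState.re_le_sum_star_mul_self {B : Type*} [CStarAlgebra B]
    {τ : B →ₗ[ℂ] ℂ} (hτ : IsTracialState τ) {n : ℕ} (x : Matrix (Fin n) (Fin n) B) (a b : Fin n) :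
    (τ (star (x a b) * x a b)).re ≤ (∑ i, τ ((star x * x) i i)).re := by
  simp only [Matrix.mul_apply, Matrix.star_apply, map_sum, Complex.re_sum]
  refine (Finset.single_le_sum (f := fun k => (τ (star (x k b) * x k b)).re)
    (fun k _ => hτ.re_nonneg _) (Finset.mem_univ a)).trans ?_
  exact Finset.single_le_sum (f := fun i => ∑ k, (τ (star (x k i) * x k i)).re)
    (fun i _ => Finset.sum_nonneg fun k _ => hτ.re_nonneg _) (Finset.mem_univ b)

variable {A : Type*} [CStarAlgebra A]

theorem IsTracialState.restrict {τ : A →ₗ[ℂ] ℂ} (hτ : IsTracialState τ) (P : StarSubalgebra ℂ A) :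
    IsTracialState (τ.comp (P.subtype.toAlgHom.toLinearMap)) :=
  ⟨hτ.map_one, fun b => hτ.nonneg b, fun b c => hτ.trace b c⟩

/-- Without tracial states the comparison hypothesis would be vacuous and give `1 ≾ 0`. -/
theorem OrderOnProjectionsDeterminedByTraces.exists_isTracialState [Nontrivial A]
    (h : OrderOnProjectionsDeterminedByTraces A) : ∃ τ : A →ₗ[ℂ] ℂ, IsTracialState τ := by
  by_contra! H
  obtain ⟨r, -, hr, v, hv1, hv2⟩ := h 1 1 0 (IsStarProjection.one _) (IsStarProjection.zero _)
    fun τ hτ => absurd hτ (H τ)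
  rw [zero_mul] at hr
  have h1 : (star v * v) * (star v * v) = 0 := by
    rw [mul_assoc, ← mul_assoc v, hv2, ← hr, zero_mul, mul_zero]
  rw [hv1, one_mul] at h1
  have h2 := congrFun (congrFun h1 0) 0
  simp at h2

/-- Subequivalence of projections through a matrix `y` with `y* y = p` and `q y = y`. -/
theorem MvNSubequiv.exists_star_mul_self_eq {R : Type*} [Ring R] [StarRing R] {p q : R}
    (hp : IsStarProjection p) (h : MvNSubequiv p q) : ∃ y, star y * y = p ∧ q * y = y := by
  obtain ⟨r, hr, hqr, v, hv1, hv2⟩ := h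
  have hpp : p * p = p := hp.isIdempotentElem
  refine ⟨r * v, ?_, by rw [← mul_assoc, hqr]⟩
  calc star (r * v) * (r * v) = star v * (r * r) * v := by
        rw [star_mul, hr.isSelfAdjoint.star_eq]; simp only [mul_assoc]
    _ = star v * r * v := by rw [hr.isIdempotentElem.eq]
    _ = (star v * v) * (star v * v) := by rw [← hv2]; simp only [mul_assoc]
    _ = p := by rw [hv1, hpp]

/-- The trace gap between projections `p`, `q` with `τ(p) < τ(q)` is uniform. -/
theorem exists_trace_gap [Nontrivial A] (hA : IsAlgebraicallySimple A)
    (htr : OrderOnProjectionsDeterminedByTraces A) {n : ℕ} {p q : Matrix (Fin n) (Fin n) A}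
    (hp : IsStarProjection p) (hq : IsStarProjection q)
    (hlt : ∀ τ : A →ₗ[ℂ] ℂ, IsTracialState τ → (∑ i, τ (p i i)).re < (∑ i, τ (q i i)).re) :
    ∃ C : ℝ, 0 < C ∧ ∀ τ : A →ₗ[ℂ] ℂ, IsTracialState τ →
      1 ≤ C * ((∑ i, τ (q i i)).re - (∑ i, τ (p i i)).re) := by
  obtain ⟨y, hy1, hy2⟩ := (htr n p q hp hq hlt).exists_star_mul_self_eq hp
  obtain ⟨τ₀, hτ₀⟩ := htr.exists_isTracialState
  have hqq : q * q = q := hq.isIdempotentElem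
  have hqs : star q = q := hq.isSelfAdjoint
  have hpp : p * p = p := hp.isIdempotentElem
  set r := y * star y with hr
  have hyq : star y * q = star y := by
    have := congrArg star hy2
    rwa [star_mul, hqs] at this
  have hqr : q * r = r := by rw [hr, ← mul_assoc, hy2]
  have hrq : r * q = r := by rw [hr, mul_assoc, hyq]
  -- `ρ` is what remains of `q` beyond a copy of `p`, so the trace of `ρ* ρ` is the gap; a nonzero
  -- entry of `ρ` bounds it below by simplicity.
  set ρ := q - r with hρ
  have key : ∀ τ : A →ₗ[ℂ] ℂ, IsTracialState τ →
      (∑ i, τ ((star ρ * ρ) i i)).re = (∑ i, τ (q i i)).re - (∑ i, τ (p i i)).re := by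
    intro τ hτ
    have hrs : star r = r := by rw [hr, star_mul, star_star]
    have e1 : star ρ * ρ = q - r - r + r * r := by
      rw [hρ, star_sub, hqs, hrs, mul_sub, sub_mul, sub_mul, hqq, hqr, hrq]; abel
    have e2 : ∑ i, τ (r i i) = ∑ i, τ (p i i) := by
      rw [hr, hτ.sum_mul_comm, hy1]
    have e3 : ∑ i, τ ((r * r) i i) = ∑ i, τ (p i i) := by
      have : r * r = y * (p * star y) := by rw [hr, ← hy1]; simp only [mul_assoc]
      rw [this, hτ.sum_mul_comm, mul_assoc, hy1, hpp]
    rw [e1]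
    simp only [Matrix.add_apply, Matrix.sub_apply, map_add, map_sub, Finset.sum_add_distrib,
      Finset.sum_sub_distrib, e2, e3, Complex.sub_re, Complex.add_re]
    ring
  have hne : ∃ a b, ρ a b ≠ 0 := by
    by_contra! H
    have h0 : ρ = 0 := by ext a b; exact H a b
    have h1 := key τ₀ hτ₀
    have h2 := hlt τ₀ hτ₀
    rw [h0, mul_zero] at h1
    simp only [Matrix.zero_apply, map_zero, Finset.sum_const_zero, Complex.zero_re] at h1
    linarith
  obtain ⟨a, b, hab⟩ := hne
  obtain ⟨C, hC, H⟩ := hA.exists_trace_lower_bound hab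
  refine ⟨C, hC, fun τ hτ => (H τ hτ).trans ?_⟩
  rw [← key τ hτ]
  exact mul_le_mul_of_nonneg_left (hτ.re_le_sum_star_mul_self ρ a b) hC.le

/-- Orthogonal copies of a projection have small trace. -/
theorem IsTracialState.card_mul_re_le_one {τ : A →ₗ[ℂ] ℂ} (hτ : IsTracialState τ) {N : ℕ}
    {w : Fin N → A} {t : A} (hwt : ∀ i, w i * t = w i)
    (hw : ∀ i j, star (w i) * w j = if i = j then t else 0) :
    N * (τ t).re ≤ 1 := by
  -- `F` is a projection of trace `N τ(t)`, and `τ(1 - F)` is nonnegative.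
  set F := ∑ j, w j * star (w j) with hF
  have hFs : star F = F := by simp [hF]
  have hFF : F * F = F := by
    simp only [hF, Finset.sum_mul_sum]
    refine Finset.sum_congr rfl fun i _ => ?_
    have : ∀ j, w i * star (w i) * (w j * star (w j)) = if i = j then w i * star (w j) else 0 := by
      intro j
      rw [mul_assoc, ← mul_assoc (star (w i)), hw]
      split_ifs
      · rw [← mul_assoc, hwt]
      · simp
    simp [this]
  have h1 := hτ.re_nonneg (1 - F)
  have e1 : star (1 - F) * (1 - F) = 1 - F := by
    rw [star_sub, star_one, hFs, mul_sub, sub_mul, sub_mul, hFF]; noncomm_ring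
  have e2 : τ F = N * τ t := by
    rw [hF, map_sum]
    have : ∀ j, τ (w j * star (w j)) = τ t := fun j => by
      rw [hτ.trace, hw, if_pos rfl]
    simp [this]
  rw [e1, map_sub, hτ.map_one, e2, Complex.sub_re, Complex.one_re] at h1
  have e3 : ((N : ℂ) * τ t).re = N * (τ t).re := by simp
  linarith

variable {P : StarSubalgebra ℂ A} {E : A →L[ℂ] P} {l : ℝ}

theorem IsRokhlinInclusion.orderOnProjectionsDeterminedByTraces (h : IsRokhlinInclusion E l)
    (htr : OrderOnProjectionsDeterminedByTraces A) : OrderOnProjectionsDeterminedByTraces P := by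
  intro n p q hp hq hlt
  have := h.nontrivial
  have := h.isClosed
  let ι : Matrix (Fin n) (Fin n) P →+* Matrix (Fin n) (Fin n) A := (P.subtype : P →+* A).mapMatrix
  have hιs : ∀ M, star (ι M) = ι (star M) := fun M => by ext i j; rfl
  have hιp : ∀ M, IsStarProjection M → IsStarProjection (ι M) := fun M hM =>
    ⟨hM.isIdempotentElem.map ι, by rw [IsSelfAdjoint, hιs, hM.isSelfAdjoint.star_eq]⟩
  have hlt' : ∀ τ : A →ₗ[ℂ] ℂ, IsTracialState τ →
      (∑ i, τ (ι p i i)).re < (∑ i, τ (ι q i i)).re := fun τ hτ => hlt _ (hτ.restrict P)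
  have hqq : q * q = q := hq.isIdempotentElem
  have hqs : star q = q := hq.isSelfAdjoint
  by_cases hfull : ∃ e, IsRokhlinProjection E l e ∧ l • expInf E e = 1
  · obtain ⟨e, he, hg⟩ := hfull
    obtain ⟨y, hy1, hy2⟩ := (htr n (ι p) (ι q) (hιp p hp) (hιp q hq) hlt').exists_star_mul_self_eq
      (hιp p hp)
    -- As `1 - g = 0`, no room has to be reserved under `q`.
    refine h.mvNSubequiv he (r := q) (Y := 0) (t := 0) hp hq (IsStarProjection.zero _) hqs hqq
      (mul_zero _) (mul_zero _) (by simp) hy1 hy2 fun ε hε => ⟨0, map_zero _, ?_⟩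
    simpa [hg] using hε
  · push Not at hfull
    obtain ⟨C, hC, hgap⟩ := exists_trace_gap h.simple htr (hιp p hp) (hιp q hq) hlt'
    have hq0 : ∃ a i, q a i ≠ 0 := by
      by_contra! H
      obtain ⟨τ, hτ⟩ := htr.exists_isTracialState
      have h0 : q = 0 := Matrix.ext fun a b => H a b
      have h1 := hlt' τ hτ
      have h2 : ∑ i, τ (ι q i i) = 0 := by
        refine Finset.sum_eq_zero fun i _ => ?_
        rw [h0, map_zero, Matrix.zero_apply, map_zero]
      have h3 : 0 ≤ (∑ i, τ (ι p i i)).re := by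
        have hpi := hιp p hp
        have e : ι p = star (ι p) * ι p := by
          rw [hpi.isSelfAdjoint.star_eq, hpi.isIdempotentElem.eq]
        rw [e]
        simp only [Matrix.mul_apply, Matrix.star_apply, map_sum, Complex.re_sum]
        exact Finset.sum_nonneg fun i _ => Finset.sum_nonneg fun j _ => hτ.re_nonneg _
      rw [h2, Complex.zero_re] at h1
      linarith
    obtain ⟨a, i₀, hai⟩ := hq0
    -- `b` has the same square as the column `i₀` of `q`, so multiplying that column by elements
    -- `xⱼ` gives columns under `q` with the inner products of the `b xⱼ`.
    obtain ⟨b, hb⟩ := exists_sum_star_mul_self_eq Finset.univ fun k => q k i₀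
    have hb0 : b ≠ 0 := by
      rintro rfl
      have := norm_sq_le_norm_sum_star_mul_self Finset.univ (fun k => q k i₀) (Finset.mem_univ a)
      rw [hb, mul_zero, norm_zero] at this
      have h1 : 0 < ‖q a i₀‖ := norm_pos_iff.2 hai
      nlinarith
    -- Of `N + n` copies of `t` the last `n` form `Y`; the total bounds the trace by `(N + n) τ(t) ≤
    -- 1`. If the gap `G` were at most `n τ(t)`, then `1 ≤ C G ≤ C n τ(t) < N τ(t) ≤ 1` when `τ(t) >
    -- 0`.
    obtain ⟨N, hN⟩ := exists_nat_gt (C * n)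
    obtain ⟨x, t, ht0, ht, hxt, hx⟩ := h.exists_projection_copies hfull hb0 (N + n)
    have hts : star t = t := ht.isSelfAdjoint
    let x' : Fin n → P := fun j => x (Fin.natAdd N j)
    let Y : Matrix (Fin n) (Fin n) P := Matrix.of fun c j => q c i₀ * x' j
    have hqY : q * Y = Y := by
      ext c j : 2
      simp only [Y, Matrix.mul_apply, Matrix.of_apply, ← mul_assoc, ← Finset.sum_mul]
      rw [← Matrix.mul_apply, hqq]
    have hYY : star Y * Y = Matrix.diagonal fun _ => t := by
      ext j k : 2
      have e1 : (star Y * Y) j k = star (b * x' j) * (b * x' k) := by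
        simp only [Y, Matrix.mul_apply, Matrix.star_apply, Matrix.of_apply, star_mul]
        calc ∑ c, star (x' j) * star (q c i₀) * (q c i₀ * x' k)
            = star (x' j) * (∑ c, star (q c i₀) * q c i₀) * x' k := by
              simp only [Finset.mul_sum, Finset.sum_mul, mul_assoc]
          _ = _ := by rw [hb]; simp only [mul_assoc]
      rw [e1, hx, Matrix.diagonal_apply]
      simp
    have hYt : Y * (Matrix.diagonal fun _ => t) = Y := by
      ext c j : 2
      simp only [Y, Matrix.mul_diagonal, Matrix.of_apply, mul_assoc, x', hxt]
    set s := Y * star Y with hs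
    have hss : s * s = s := by
      rw [hs, mul_assoc, ← mul_assoc (star Y), hYY, ← mul_assoc, hYt]
    have hsstar : star s = s := by rw [hs, star_mul, star_star]
    have hqs' : q * s = s := by rw [hs, ← mul_assoc, hqY]
    have hsq : s * q = s := by
      have := congrArg star hqs'
      rwa [star_mul, hsstar, hqs] at this
    set r := q - s with hr
    have hrs : star r = r := by rw [hr, star_sub, hqs, hsstar]
    have hrr : r * r = r := by
      rw [hr, mul_sub, sub_mul, sub_mul, hqq, hqs', hsq, hss, sub_self, sub_zero]
    have hrY : r * Y = 0 := by
      rw [hr, sub_mul, hqY, hs, mul_assoc, hYY, hYt, sub_self]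
    have hlt'' : ∀ τ : A →ₗ[ℂ] ℂ, IsTracialState τ →
        (∑ i, τ (ι p i i)).re < (∑ i, τ (ι r i i)).re := by
      intro τ hτ
      have e1 : ∑ i, τ (ι s i i) = n * τ (t : A) := by
        have : ι s = ι Y * star (ι Y) := by rw [hs, map_mul, hιs]
        rw [this, hτ.sum_mul_comm, hιs, ← map_mul, hYY]
        have : ∀ i, ι (Matrix.diagonal fun _ => t) i i = (t : A) := fun i => by
          change ((Matrix.diagonal (fun _ => t) i i : P) : A) = t
          rw [Matrix.diagonal_apply_eq]
        simp [this]
      have e2 : ((N + n : ℕ) : ℝ) * (τ (t : A)).re ≤ 1 := by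
        refine hτ.card_mul_re_le_one (w := fun j => ((b * x j : P) : A)) (fun j => ?_)
          fun j k => ?_
        · exact congrArg (Subtype.val : P → A) (show b * x j * t = b * x j by
            rw [mul_assoc, hxt])
        · have := congrArg (Subtype.val : P → A) (hx j k)
          rw [apply_ite (Subtype.val : P → A)] at this
          exact this
      have e3 : 0 ≤ (τ (t : A)).re := by
        have : (t : A) = star (t : A) * t :=
          congrArg (Subtype.val : P → A) (show t = star t * t by rw [hts, ht.isIdempotentElem.eq])
        rw [this]; exact hτ.re_nonneg _
      have e4 : ((n : ℂ) * τ (t : A)).re = n * (τ (t : A)).re := by simp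
      have e5 := hgap τ hτ
      have e6 : ∑ i, τ (ι r i i) = ∑ i, τ (ι q i i) - n * τ (t : A) := by
        rw [← e1, ← Finset.sum_sub_distrib]
        refine Finset.sum_congr rfl fun i _ => ?_
        rw [hr, map_sub, Matrix.sub_apply, map_sub]
      rw [e6, Complex.sub_re, e4]
      set T := (τ (t : A)).re
      set G := (∑ i, τ (ι q i i)).re - (∑ i, τ (ι p i i)).re with hG
      have hGT : n * T < G := by
        rcases e3.eq_or_lt with h0 | h0
        · have : 0 < G := sub_pos.2 (hlt' τ hτ)
          rw [← h0, mul_zero]; exact this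
        · push_cast at e2
          by_contra! hcon
          have h7 : (0 : ℝ) ≤ n * T := by positivity
          have h8 : C * (n * T) < N * T := by
            rw [← mul_assoc]; exact mul_lt_mul_of_pos_right hN h0
          have h9 : C * G ≤ C * (n * T) := by gcongr
          nlinarith
      linarith
    obtain ⟨y, hy1, hy2⟩ := (htr n (ι p) (ι r) (hιp p hp) (hιp r ⟨hrr, hrs⟩)
      hlt'').exists_star_mul_self_eq (hιp p hp)
    obtain ⟨e, he, hX⟩ := h.exists_isRokhlinProjection t ht0
    refine h.mvNSubequiv he hp hq ht hrs ?_ hqY hrY hYY hy1 hy2 hX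
    rw [hr, mul_sub, hqq, hqs']

end Main

theorem corollary7p3 {A : Type*} [CStarAlgebra A] (P : StarSubalgebra ℂ A)
    (hP : IsClosed (P : Set A)) (E : A →L[ℂ] P) (hE : IsConditionalExpectation E)
    (hfin : IsIndexFinite E) (hR : HasTracialRokhlinProperty E)
    (hA : IsSimpleCStarAlgebra A) (htr : OrderOnProjectionsDeterminedByTraces A) :
    OrderOnProjectionsDeterminedByTraces P := by
  have := hA.1
  have hsimple := hA.isAlgebraicallySimple
  obtain ⟨l, hl, hidx⟩ := hE.exists_index_eq_smul hP hfin hsimple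
  obtain ⟨n, w, hw⟩ := hE.exists_isQuasiBasis_star hP hfin
  have hcut : ∀ e, IsRokhlinProjection E l e → ∀ x, l • (e * expInf E (e * x)) = e * x :=
    fun e he x => he.smul_mul_expInf hE hl hidx hw x
  have h : IsRokhlinInclusion E l :=
    { nontrivial := hA.1
      simple := hsimple
      isClosed := hP
      expectation := hE
      cut := hcut
      exists_isRokhlinProjection := fun z hz =>
        hR.exists_isRokhlinProjection hE hl hidx hcut hz }
  exact h.orderOnProjectionsDeterminedByTraces htr
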